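/- Let $N$ be the number of bosonic modes, $\mathcal F=\ell^2(\mathbb N^N,\mathbb C)$ the Fock space with number basis $|n\rangle$, $n\in\mathbb N^N$, and $\hat a_k,\hat a_k^\dagger$ ($1\le k\le N$) the annihilation and creation operators, $\hat a_k|n\rangle=\sqrt{n_k}\,|n-e_k\rangle$, $\hat a_k^\dagger|n\rangle=\sqrt{n_k+1}\,|n+e_k\rangle$. A state is a positive operator $\hat\rho$ on $\mathcal F$ of trace $1$. The reduced state of the field (RSF) of $\hat\rho$ is the pair $(r,|\alpha\rangle)$ with $$r_{kk'}=\mathrm{Tr}[\hat\rho\,\hat a_{k'}^\dagger\hat a_k],\qquad \alpha_k=\mathrm{Tr}[\hat\rho\,\hat a_k],$$ where $\mathrm{Tr}[\hat\rho\hat A]=\sum_n\langle n|\hat\rho\hat A|n\rangle$ and the series are required to converge absolutely. Put $r_\alpha=r-|\alpha\rangle\langle\alpha|$. The Husimi function of $\hat\rho$ is $Q(\vec\beta)=\langle\vec\beta|\hat\rho|\vec\beta\rangle$, $\vec\beta\in\mathbb C^N$, where $|\vec\beta\rangle=e^{-|\vec\beta|^2/2}\sum_n\prod_k\frac{\beta_k^{n_k}}{\sqrt{n_k!}}|n\rangle$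 is the coherent state, and the Wehrl entropy is $$S_W(\hat\rho)=-k_B\int_{\mathbb C^N}\frac{d^{2N}\vec\beta}{\pi^N}\,Q(\vec\beta)\log Q(\vec\beta),\qquad k_B>0.$$ Let $(r,|\alpha\rangle)$ be the RSF of some state. Then $r_\alpha\ge 0$, the function $Q\log Q$ is integrable for every state with RSF $(r,|\alpha\rangle)$, and the maximum of $S_W(\hat\rho)$ over all states $\hat\rho$ with RSF $(r,|\alpha\rangle)$ exists and equals $$k_B\,\mathrm{tr}\log(r_\alpha+\mathbb 1_N)+k_BN.$$ Moreover, there is a state whose Husimi function is the Gaussian with mean $\vec\alpha$ and covariance $r_\alpha+\mathbb 1_N$, $$\tilde Q(\vec\beta)=\frac{1}{\det(r_\alpha+\mathbb 1_N)}\,e^{-(\vec\beta-\vec\alpha)^\dagger(r_\alpha+\mathbb 1_N)^{-1}(\vec\beta-\vec\alpha)},$$ and every state with this Husimi function has RSF $(r,|\alpha\rangle)$ and attains the maximum. -/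

import Mathlib

open MeasureTheory
open scoped ComplexOrder

noncomputable section

namespace BosonField

/-- Occupation numbers of the `N` bosonic modes. -/
abbrev Occ (N : ℕ) : Type := Fin N → ℕ

/-- The `N`-mode Fock space in the occupation number representation: `ℓ²(ℕ^N, ℂ)`. -/
abbrev FockSpace (N : ℕ) : Type := lp (fun _ : Occ N => ℂ) 2

/-- The number state `|n⟩ = |n₁, …, n_N⟩`; these form the standard orthonormal basis. -/
def numberState {N : ℕ} (n : Occ N) : FockSpace N := lp.single 2 n (1 : ℂ)

/-- Finite linear combinations of number states: a common invariant domain of all polynomials in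
the creation and annihilation operators. -/
abbrev FiniteFock (N : ℕ) : Type := Occ N →₀ ℂ

/-- The inclusion of the finite linear combinations of number states in the Fock space. -/
def toFock (N : ℕ) : FiniteFock N →ₗ[ℂ] FockSpace N :=
  Finsupp.linearCombination ℂ (numberState (N := N))

/-- The annihilation operator of mode `k`: `a_k |n⟩ = √(n_k) |n - e_k⟩` (which is `0` if
`n_k = 0`). -/
def annihilation {N : ℕ} (k : Fin N) : FiniteFock N →ₗ[ℂ] FiniteFock N :=
  Finsupp.linearCombination ℂ fun n : Occ N =>
    Finsupp.single (n - Pi.single k 1) ((Real.sqrt (n k : ℝ) : ℝ) : ℂ)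

/-- The creation operator of mode `k`: `a_k† |n⟩ = √(n_k + 1) |n + e_k⟩`. -/
def creation {N : ℕ} (k : Fin N) : FiniteFock N →ₗ[ℂ] FiniteFock N :=
  Finsupp.linearCombination ℂ fun n : Occ N =>
    Finsupp.single (n + Pi.single k 1) ((Real.sqrt ((n k : ℝ) + 1) : ℝ) : ℂ)

/-- `ρ` is a density operator: a positive bounded operator of trace `1`. -/
structure IsDensityOperator {N : ℕ} (ρ : FockSpace N →L[ℂ] FockSpace N) : Prop where
  isPositive : ρ.IsPositive
  trace_one : HasSum (fun n : Occ N => inner ℂ (numberState n) (ρ (numberState n))) 1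

/-- `Tr[ρ A] = x`: the series `∑ₙ ⟨n| ρ A |n⟩` over the number basis converges
unconditionally, with sum `x`. -/
def HasExpectation {N : ℕ} (ρ : FockSpace N →L[ℂ] FockSpace N)
    (A : FiniteFock N →ₗ[ℂ] FiniteFock N) (x : ℂ) : Prop :=
  HasSum (fun n : Occ N =>
    inner ℂ (numberState n) (ρ (toFock N (A (Finsupp.single n 1))))) x

/-- `(r, α)` is the reduced state of the field of `ρ`: the single-particle density matrix is
`r k k' = Tr[ρ a_{k'}† a_k]` and the averaged field is `α k = Tr[ρ a_k]`. For `k = k'` this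
includes that the mean particle numbers of `ρ` are finite. -/
structure HasRSF {N : ℕ} (ρ : FockSpace N →L[ℂ] FockSpace N)
    (r : Matrix (Fin N) (Fin N) ℂ) (α : Fin N → ℂ) : Prop where
  singleParticle : ∀ k k' : Fin N, HasExpectation ρ (creation k' ∘ₗ annihilation k) (r k k')
  averagedField : ∀ k : Fin N, HasExpectation ρ (annihilation k) (α k)

/-- The correlation matrix `r_α = r - |α⟩⟨α|`. -/
def correlationMatrix {N : ℕ} (r : Matrix (Fin N) (Fin N) ℂ) (α : Fin N → ℂ) :
    Matrix (Fin N) (Fin N) ℂ :=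
  r - Matrix.vecMulVec α (star α)

/-- The coefficient `⟨n|β⟩ = e^{-|β|²/2} ∏ₖ βₖ^{nₖ} / √(nₖ!)` of the coherent state `|β⟩`. -/
def coherentCoeff {N : ℕ} (β : Fin N → ℂ) (n : Occ N) : ℂ :=
  ((Real.exp (-(∑ k, ‖β k‖ ^ 2) / 2) : ℝ) : ℂ) *
    ∏ k, (β k ^ n k / ((Real.sqrt ((n k).factorial : ℝ) : ℝ) : ℂ))

theorem coherentCoeff_memℓp {N : ℕ} (β : Fin N → ℂ) :
    Memℓp (E := fun _ : Occ N => ℂ) (coherentCoeff β) 2 := by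
  rw [memℓp_gen_iff (by norm_num)]
  have key : ∀ n : Occ N, ‖coherentCoeff β n‖ ^ (2 : ENNReal).toReal =
      Real.exp (-(∑ k, ‖β k‖ ^ 2) / 2) ^ 2 *
        ∏ k, ((‖β k‖ ^ 2) ^ n k / ((n k).factorial : ℝ)) := by
    intro n
    have h2 : (2 : ENNReal).toReal = ((2 : ℕ) : ℝ) := by norm_num
    rw [h2, Real.rpow_natCast, coherentCoeff, norm_mul, mul_pow, norm_prod, ← Finset.prod_pow,
      Complex.norm_real, Real.norm_eq_abs, sq_abs]
    congr 1
    refine Finset.prod_congr rfl fun k _ => ?_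
    rw [norm_div, norm_pow, Complex.norm_real, Real.norm_eq_abs, div_pow, sq_abs,
      Real.sq_sqrt (Nat.cast_nonneg _), ← pow_mul, ← pow_mul, mul_comm]
  simp only [key]
  refine Summable.mul_left _ ?_
  refine summable_of_sum_le (c := ∏ k, Real.exp (‖β k‖ ^ 2))
    (fun n => Finset.prod_nonneg fun k _ => by positivity) fun s => ?_
  let M : Fin N → Finset ℕ := fun k => Finset.range (s.sup (fun n => n k) + 1)
  have hs : s ⊆ Fintype.piFinset M := by
    intro n hn
    refine Fintype.mem_piFinset.2 fun k => ?_
    exact Finset.mem_range.2 (Nat.lt_succ_of_le (Finset.le_sup (f := fun n : Occ N => n k) hn))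
  calc ∑ n ∈ s, ∏ k, ((‖β k‖ ^ 2) ^ n k / ((n k).factorial : ℝ))
      ≤ ∑ n ∈ Fintype.piFinset M, ∏ k, ((‖β k‖ ^ 2) ^ n k / ((n k).factorial : ℝ)) :=
        Finset.sum_le_sum_of_subset_of_nonneg hs fun n _ _ =>
          Finset.prod_nonneg fun k _ => by positivity
    _ = ∏ k, ∑ j ∈ M k, ((‖β k‖ ^ 2) ^ j / (j.factorial : ℝ)) :=
        (Finset.prod_univ_sum M fun k j => (‖β k‖ ^ 2) ^ j / (j.factorial : ℝ)).symm
    _ ≤ ∏ k, Real.exp (‖β k‖ ^ 2) :=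
        Finset.prod_le_prod (fun k _ => Finset.sum_nonneg fun j _ => by positivity)
          fun k _ => Real.sum_le_exp_of_nonneg (by positivity) _

/-- The `N`-mode coherent state `|β⟩`. -/
def coherentState {N : ℕ} (β : Fin N → ℂ) : FockSpace N :=
  ⟨coherentCoeff β, coherentCoeff_memℓp β⟩

/-- The Husimi function `Q(β) = ⟨β| ρ |β⟩` (a real number for self-adjoint `ρ`). -/
def husimiQ {N : ℕ} (ρ : FockSpace N →L[ℂ] FockSpace N) (β : Fin N → ℂ) : ℝ :=
  (inner ℂ (coherentState β) (ρ (coherentState β))).re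

/-- The Wehrl entropy `S_W(ρ) = -k_B ∫ Q(β) log Q(β) d^{2N}β / π^N`; the measure on `ℂ^N` is the
Lebesgue measure in the real and imaginary parts of the components. -/
def wehrlEntropy {N : ℕ} (kB : ℝ) (ρ : FockSpace N →L[ℂ] FockSpace N) : ℝ :=
  -kB * ∫ β : Fin N → ℂ, husimiQ ρ β * Real.log (husimiQ ρ β) / Real.pi ^ N

/-- The reduced Wehrl entropy `k_B tr log(r_α + 1) + k_B N`. -/
def reducedWehrlEntropy {N : ℕ} (kB : ℝ) (r : Matrix (Fin N) (Fin N) ℂ) (α : Fin N → ℂ) : ℝ :=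
  kB * (Matrix.trace (cfc Real.log (correlationMatrix r α + 1))).re + kB * N

/-- The Gaussian `det(r_α + 1)⁻¹ exp(-(β - α)† (r_α + 1)⁻¹ (β - α))`. -/
def gaussianQ {N : ℕ} (r : Matrix (Fin N) (Fin N) ℂ) (α β : Fin N → ℂ) : ℝ :=
  (correlationMatrix r α + 1).det.re⁻¹ *
    Real.exp (-(star (β - α) ⬝ᵥ ((correlationMatrix r α + 1)⁻¹).mulVec (β - α)).re)

end BosonField

end

noncomputable section
namespace BosonField

section Bargmann

/-- The normalized Lebesgue measure `d^{2N}β / π^N` on phase space. -/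
def phaseMeasure (N : ℕ) : Measure (Fin N → ℂ) := ENNReal.ofReal ((Real.pi ^ N)⁻¹) • volume

theorem integral_phaseMeasure {N : ℕ} {E : Type*} [NormedAddCommGroup E] [NormedSpace ℝ E]
    (f : (Fin N → ℂ) → E) :
    ∫ β, f β ∂phaseMeasure N = (Real.pi ^ N)⁻¹ • ∫ β, f β := by
  rw [phaseMeasure, integral_smul_measure, ENNReal.toReal_ofReal (by positivity)]

theorem integrable_phaseMeasure {N : ℕ} {E : Type*} [NormedAddCommGroup E]
    {f : (Fin N → ℂ) → E} : Integrable f (phaseMeasure N) ↔ Integrable f := by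
  rw [phaseMeasure, integrable_smul_measure (by simpa using by positivity) (by simp)]

/-- The coefficients of a one-mode coherent state. -/
def modeCoeff (n : ℕ) (z : ℂ) : ℂ :=
  ((Real.exp (-‖z‖ ^ 2 / 2) : ℝ) : ℂ) * (z ^ n / ((Real.sqrt (n.factorial : ℝ) : ℝ) : ℂ))

theorem coherentCoeff_eq_prod {N : ℕ} (β : Fin N → ℂ) (n : Occ N) :
    coherentCoeff β n = ∏ k, modeCoeff (n k) (β k) := by
  simp only [coherentCoeff, modeCoeff]
  rw [Finset.prod_mul_distrib, ← Complex.ofReal_prod, ← Real.exp_sum, ← Finset.sum_div,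
    Finset.sum_neg_distrib]

theorem continuous_coherentCoeff {N : ℕ} (n : Occ N) :
    Continuous fun β : Fin N → ℂ => coherentCoeff β n := by
  unfold coherentCoeff
  fun_prop

theorem integral_modeCoeff_ne {m n : ℕ} (h : m ≠ n) :
    ∫ z, star (modeCoeff m z) * modeCoeff n z = 0 := by
  let u : Circle := Circle.exp 1
  have hu (z : ℂ) : star (modeCoeff m (rotation u z)) * modeCoeff n (rotation u z) =
      (star (u : ℂ) ^ m * (u : ℂ) ^ n) * (star (modeCoeff m z) * modeCoeff n z) := by
    simp only [modeCoeff, rotation_apply, norm_mul, Circle.norm_coe, one_mul, mul_pow, star_mul',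
      star_div₀, star_pow]
    ring
  have key := (rotation u).measurePreserving.integral_comp
    (rotation u).toHomeomorph.measurableEmbedding
    (fun z => star (modeCoeff m z) * modeCoeff n z)
  simp only [hu] at key
  rw [integral_const_mul] at key
  have hne : star (u : ℂ) ^ m * (u : ℂ) ^ n ≠ 1 := by
    intro h1
    have h2 : (u : ℂ) = Complex.exp Complex.I := by simp [u, Circle.coe_exp]
    have h3 : star (u : ℂ) = Complex.exp (-Complex.I) := by
      rw [h2, ← starRingEnd_apply, ← Complex.exp_conj, Complex.conj_I]
    rw [h3, h2, ← Complex.exp_nat_mul, ← Complex.exp_nat_mul, ← Complex.exp_add,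
      Complex.exp_eq_one_iff] at h1
    obtain ⟨j, hj⟩ := h1
    have h4 : ((n : ℝ) - m) = j * (2 * Real.pi) := by
      have := congrArg Complex.im hj
      simp at this
      linarith
    rcases eq_or_ne j 0 with rfl | hj0
    · simp [sub_eq_zero] at h4
      exact h h4.symm
    · refine irrational_pi.ne_rat (((n : ℚ) - m) / (2 * j)) ?_
      have : (j : ℝ) ≠ 0 := by exact_mod_cast hj0
      push_cast
      field_simp
      linarith
  have : (star (u : ℂ) ^ m * (u : ℂ) ^ n - 1) * ∫ z, star (modeCoeff m z) * modeCoeff n z = 0 := by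
    rw [sub_mul, key]; ring
  exact (mul_eq_zero.1 this).resolve_left (sub_ne_zero.2 hne)

theorem integral_modeCoeff_self (n : ℕ) :
    ∫ z, star (modeCoeff n z) * modeCoeff n z = Real.pi := by
  have h1 (z : ℂ) : star (modeCoeff n z) * modeCoeff n z =
      (((n.factorial : ℝ)⁻¹ * (‖z‖ ^ ((2 * n : ℕ) : ℝ) * Real.exp (-‖z‖ ^ (2 : ℝ))) : ℝ) : ℂ) := by
    rw [← starRingEnd_apply, ← Complex.normSq_eq_conj_mul_self, Complex.normSq_eq_norm_sq]
    congr 1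
    rw [modeCoeff, norm_mul, norm_div, norm_pow, Complex.norm_real, Complex.norm_real,
      Real.norm_of_nonneg (Real.exp_nonneg _), Real.norm_of_nonneg (Real.sqrt_nonneg _), mul_pow,
      div_pow, Real.sq_sqrt (by positivity), ← Real.exp_nat_mul, Real.rpow_natCast,
      ← pow_mul]
    norm_num
    ring_nf
  simp_rw [h1]
  rw [integral_complex_ofReal, integral_const_mul,
    Complex.integral_rpow_mul_exp_neg_rpow (by norm_num) (by push_cast; linarith)]
  have : (((2 * n : ℕ) : ℝ) + 2) / 2 = n + 1 := by push_cast; ring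
  rw [this, Real.Gamma_nat_eq_factorial]
  have : (n.factorial : ℝ) ≠ 0 := by positivity
  field_simp

theorem integral_coherentCoeff {N : ℕ} (m n : Occ N) :
    ∫ β, star (coherentCoeff β m) * coherentCoeff β n ∂phaseMeasure N = if m = n then 1 else 0 := by
  rw [integral_phaseMeasure]
  simp_rw [coherentCoeff_eq_prod, star_prod, ← Finset.prod_mul_distrib]
  rw [integral_fintype_prod_volume_eq_prod
    (fun k z => star (modeCoeff (m k) z) * modeCoeff (n k) z)]
  split_ifs with h
  · subst h
    simp_rw [integral_modeCoeff_self]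
    rw [Finset.prod_const, Finset.card_univ, Fintype.card_fin, ← Complex.ofReal_pow,
      ← Complex.coe_smul, smul_eq_mul, ← Complex.ofReal_mul, inv_mul_cancel₀ (by positivity),
      Complex.ofReal_one]
  · obtain ⟨k, hk⟩ := Function.ne_iff.1 h
    rw [Finset.prod_eq_zero (Finset.mem_univ k) (integral_modeCoeff_ne hk), smul_zero]

theorem memLp_coherentCoeff {N : ℕ} (n : Occ N) :
    MemLp (fun β => coherentCoeff β n) 2 (phaseMeasure N) := by
  rw [memLp_two_iff_integrable_sq_norm (continuous_coherentCoeff n).aestronglyMeasurable]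
  have h : Integrable (fun β => star (coherentCoeff β n) * coherentCoeff β n) (phaseMeasure N) := by
    apply Integrable.of_integral_ne_zero
    rw [integral_coherentCoeff]
    simp
  refine h.norm.congr (.of_forall fun β => ?_)
  simp [sq]

/-- Square integrability of a sequence of vectors, as summability. -/
theorem memℓp_two_iff {ι H : Type*} [NormedAddCommGroup H] {v : ι → H} :
    Memℓp (E := fun _ => H) v 2 ↔ Summable fun n => ‖v n‖ ^ 2 := by
  rw [memℓp_gen_iff (by norm_num)]
  simp

variable {H : Type*} [NormedAddCommGroup H] [InnerProductSpace ℂ H] {N : ℕ}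

theorem memLp_coherentCoeff_smul (n : Occ N) (h : H) :
    MemLp (fun β => coherentCoeff β n • h) 2 (phaseMeasure N) :=
  (memLp_coherentCoeff n).of_le_mul (c := ‖h‖)
    ((continuous_coherentCoeff n).smul continuous_const).aestronglyMeasurable
    (.of_forall fun β => by rw [norm_smul, mul_comm])

/-- The function `β ↦ ∑ₙ ⟨n|β⟩ vₙ` on phase space. -/
def bargmann (v : Occ N → H) (β : Fin N → ℂ) : H := ∑' n, coherentCoeff β n • v n

theorem summable_bargmann [CompleteSpace H] {v : Occ N → H} (hv : Memℓp (E := fun _ => H) v 2)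
    (β : Fin N → ℂ) : Summable fun n => coherentCoeff β n • v n := by
  refine Summable.of_norm_bounded (g := fun n => ‖coherentCoeff β n‖ ^ 2 + ‖v n‖ ^ 2)
    ((memℓp_two_iff.1 (coherentCoeff_memℓp β)).add (memℓp_two_iff.1 hv)) fun n => ?_
  rw [norm_smul]
  nlinarith [sq_nonneg (‖coherentCoeff β n‖ - ‖v n‖), sq_nonneg (‖coherentCoeff β n‖),
    sq_nonneg (‖v n‖)]

theorem inner_toLp_coherentCoeff_smul (m n : Occ N) (g h : H) :
    inner ℂ ((memLp_coherentCoeff_smul m g).toLp) ((memLp_coherentCoeff_smul n h).toLp) =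
      if m = n then inner ℂ g h else 0 := by
  rw [L2.inner_def]
  have h1 : ∀ᵐ β ∂phaseMeasure N, inner ℂ ((memLp_coherentCoeff_smul m g).toLp _ β)
      ((memLp_coherentCoeff_smul n h).toLp _ β) =
      (star (coherentCoeff β m) * coherentCoeff β n) * inner ℂ g h := by
    filter_upwards [(memLp_coherentCoeff_smul m g).coeFn_toLp,
      (memLp_coherentCoeff_smul n h).coeFn_toLp] with β h1 h2
    rw [h1, h2, inner_smul_left, inner_smul_right, starRingEnd_apply]
    ring
  rw [integral_congr_ae h1, integral_mul_const, integral_coherentCoeff]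
  split_ifs <;> simp

/-- The isometry `h ↦ ⟨n|·⟩ h` from `H` to the square integrable functions on phase space. -/
def coherentIsometry (n : Occ N) : H →ₗᵢ[ℂ] Lp H 2 (phaseMeasure N) where
  toFun h := (memLp_coherentCoeff_smul n h).toLp
  map_add' g h := by
    rw [← MemLp.toLp_add]
    congr 1
    ext β
    simp
  map_smul' c h := by
    rw [RingHom.id_apply, ← MemLp.toLp_const_smul]
    congr 1
    ext β
    simp [smul_comm c]
  norm_map' h := by
    have := inner_toLp_coherentCoeff_smul n n h h
    rw [if_pos rfl, inner_self_eq_norm_sq_to_K, inner_self_eq_norm_sq_to_K] at this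
    exact (sq_eq_sq₀ (norm_nonneg _) (norm_nonneg _)).1 (by exact_mod_cast this)

theorem orthogonalFamily_coherentIsometry :
    OrthogonalFamily ℂ (fun _ : Occ N => H) (coherentIsometry (H := H)) := by
  intro m n hmn g h
  exact (inner_toLp_coherentCoeff_smul m n g h).trans (if_neg hmn)

variable [CompleteSpace H]

/-- The vector-valued Bargmann transform, as an isometry. -/
def bargmannIsometry (N : ℕ) (H : Type*) [NormedAddCommGroup H] [InnerProductSpace ℂ H]
    [CompleteSpace H] : lp (fun _ : Occ N => H) 2 →ₗᵢ[ℂ] Lp H 2 (phaseMeasure N) :=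
  (orthogonalFamily_coherentIsometry (N := N) (H := H)).linearIsometry

theorem bargmannIsometry_ae_eq (f : lp (fun _ : Occ N => H) 2) :
    bargmannIsometry N H f =ᵐ[phaseMeasure N] bargmann f := by
  have h1 := (orthogonalFamily_coherentIsometry (N := N) (H := H)).hasSum_linearIsometry f
  obtain ⟨ns, hns, hlim⟩ := (tendstoInMeasure_of_tendsto_Lp h1).exists_seq_tendsto_ae'
  have h2 : ∀ᵐ β ∂phaseMeasure N, ∀ n : Occ N, coherentIsometry n (f n) β =
      coherentCoeff β n • f n :=
    ae_all_iff.2 fun n => (memLp_coherentCoeff_smul n (f n)).coeFn_toLp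
  have h3 : ∀ᵐ β ∂phaseMeasure N, ∀ s : Finset (Occ N),
      (∑ n ∈ s, coherentIsometry n (f n) : Lp H 2 (phaseMeasure N)) β =
      ∑ n ∈ s, coherentIsometry n (f n) β :=
    ae_all_iff.2 fun s => by
      filter_upwards [Lp.coeFn_finsetSum s fun n => coherentIsometry n (f n)] with β hβ
      rw [hβ, Finset.sum_apply]
  filter_upwards [hlim, h2, h3] with β h4 h5 h6
  refine tendsto_nhds_unique h4 ?_
  simp only [h6, h5]
  exact (summable_bargmann (lp.memℓp f) β).hasSum.comp hns

variable {v w : Occ N → H}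

theorem memLp_bargmann (hv : Memℓp (E := fun _ => H) v 2) :
    MemLp (bargmann v) 2 (phaseMeasure N) :=
  (memLp_congr_ae (bargmannIsometry_ae_eq ⟨v, hv⟩)).1 (Lp.memLp _)

theorem integrable_inner_bargmann (hv : Memℓp (E := fun _ => H) v 2)
    (hw : Memℓp (E := fun _ => H) w 2) :
    Integrable (fun β => inner ℂ (bargmann v β) (bargmann w β)) (phaseMeasure N) := by
  refine (L2.integrable_inner (𝕜 := ℂ) (bargmannIsometry N H ⟨v, hv⟩)
    (bargmannIsometry N H ⟨w, hw⟩)).congr ?_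
  filter_upwards [bargmannIsometry_ae_eq (⟨v, hv⟩ : lp (fun _ : Occ N => H) 2),
    bargmannIsometry_ae_eq (⟨w, hw⟩ : lp (fun _ : Occ N => H) 2)] with β h1 h2
  rw [h1, h2]

theorem integral_inner_bargmann (hv : Memℓp (E := fun _ => H) v 2)
    (hw : Memℓp (E := fun _ => H) w 2) :
    HasSum (fun n => inner ℂ (v n) (w n))
      (∫ β, inner ℂ (bargmann v β) (bargmann w β) ∂phaseMeasure N) := by
  have h := lp.hasSum_inner (𝕜 := ℂ) (⟨v, hv⟩ : lp (fun _ : Occ N => H) 2) ⟨w, hw⟩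
  rw [← (bargmannIsometry N H).inner_map_map, L2.inner_def] at h
  convert! h using 1
  refine integral_congr_ae ?_
  filter_upwards [bargmannIsometry_ae_eq (⟨v, hv⟩ : lp (fun _ : Occ N => H) 2),
    bargmannIsometry_ae_eq (⟨w, hw⟩ : lp (fun _ : Occ N => H) 2)] with β h1 h2
  rw [h1, h2]

end Bargmann

section Ladder

section Shift

variable {N : ℕ}

theorem sub_add_single {n : Occ N} {k : Fin N} (h : n k ≠ 0) :
    n - Pi.single k 1 + Pi.single k 1 = n := by
  refine tsub_add_cancel_of_le fun j => ?_
  rcases eq_or_ne j k with rfl | hj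
  · simpa using Nat.one_le_iff_ne_zero.2 h
  · simp [hj]

theorem mem_range_add_single {n : Occ N} {k : Fin N} (h : n k ≠ 0) :
    n ∈ Set.range fun m : Occ N => m + Pi.single k 1 :=
  ⟨n - Pi.single k 1, sub_add_single h⟩

theorem add_single_injective (k : Fin N) :
    Function.Injective fun m : Occ N => m + Pi.single k 1 :=
  add_left_injective _

variable {E : Type*} [AddCommMonoid E] [TopologicalSpace E] {f : Occ N → E} {k : Fin N}

theorem hasSum_shift_iff (hf : ∀ n : Occ N, n k = 0 → f n = 0) {a : E} :
    HasSum (fun m : Occ N => f (m + Pi.single k 1)) a ↔ HasSum f a :=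
  (add_single_injective k).hasSum_iff fun n hn =>
    hf n (not_not.1 fun h => hn (mem_range_add_single h))

theorem summable_shift_iff (hf : ∀ n : Occ N, n k = 0 → f n = 0) :
    Summable (fun m : Occ N => f (m + Pi.single k 1)) ↔ Summable f :=
  (add_single_injective k).summable_iff fun n hn =>
    hf n (not_not.1 fun h => hn (mem_range_add_single h))

theorem tsum_shift [T2Space E] (hf : ∀ n : Occ N, n k = 0 → f n = 0) :
    ∑' m : Occ N, f (m + Pi.single k 1) = ∑' n, f n :=
  (add_single_injective k).tsum_eq fun n hn =>
    mem_range_add_single fun h => hn (hf n h)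

end Shift

variable {H : Type*} [NormedAddCommGroup H] [InnerProductSpace ℂ H] {N : ℕ}

/-- The creation operator of mode `k` acting on families of vectors indexed by the number basis. -/
def raiseFamily (k : Fin N) (v : Occ N → H) (n : Occ N) : H :=
  ((Real.sqrt (n k : ℝ) : ℝ) : ℂ) • v (n - Pi.single k 1)

/-- The annihilation operator of mode `k` acting on families of vectors indexed by the number
basis. -/
def lowerFamily (k : Fin N) (v : Occ N → H) (n : Occ N) : H :=
  ((Real.sqrt ((n k : ℝ) + 1) : ℝ) : ℂ) • v (n + Pi.single k 1)

variable {v : Occ N → H} {k k' : Fin N}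

theorem norm_sq_raiseFamily (n : Occ N) :
    ‖raiseFamily k v n‖ ^ 2 = n k * ‖v (n - Pi.single k 1)‖ ^ 2 := by
  rw [raiseFamily, norm_smul, mul_pow, Complex.norm_real, Real.norm_eq_abs, sq_abs,
    Real.sq_sqrt (by positivity)]

theorem norm_sq_lowerFamily (n : Occ N) :
    ‖lowerFamily k v n‖ ^ 2 = (n k + 1) * ‖v (n + Pi.single k 1)‖ ^ 2 := by
  rw [lowerFamily, norm_smul, mul_pow, Complex.norm_real, Real.norm_eq_abs, sq_abs,
    Real.sq_sqrt (by positivity)]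

theorem memℓp_raiseFamily_iff : Memℓp (E := fun _ => H) (raiseFamily k v) 2 ↔
    Summable fun n : Occ N => ((n k : ℝ) + 1) * ‖v n‖ ^ 2 := by
  rw [memℓp_two_iff, ← summable_shift_iff (k := k) (by simp +contextual [raiseFamily])]
  simp [norm_sq_raiseFamily]

theorem memℓp_raiseFamily (hv : Memℓp (E := fun _ => H) v 2)
    (h : Summable fun n : Occ N => (n k : ℝ) * ‖v n‖ ^ 2) :
    Memℓp (E := fun _ => H) (raiseFamily k v) 2 := by
  rw [memℓp_raiseFamily_iff]
  simpa only [add_mul, one_mul] using h.add (memℓp_two_iff.1 hv)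

theorem memℓp_lowerFamily_iff : Memℓp (E := fun _ => H) (lowerFamily k v) 2 ↔
    Summable fun n : Occ N => (n k : ℝ) * ‖v n‖ ^ 2 := by
  rw [memℓp_two_iff, ← summable_shift_iff (k := k)
    (f := fun n : Occ N => (n k : ℝ) * ‖v n‖ ^ 2) (by simp +contextual)]
  simp [norm_sq_lowerFamily]

theorem hasSum_inner_lowerFamily_iff {a : ℂ} :
    HasSum (fun n => inner ℂ (lowerFamily k v n) (lowerFamily k' v n)) a ↔
      HasSum (fun n : Occ N => ((Real.sqrt (n k : ℝ) : ℝ) : ℂ) *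
        (((Real.sqrt (((n - Pi.single k 1 : Occ N) k' : ℝ) + 1) : ℝ) : ℂ) *
          inner ℂ (v n) (v (n - Pi.single k 1 + Pi.single k' 1)))) a := by
  rw [← hasSum_shift_iff (k := k) (f := fun n : Occ N => ((Real.sqrt (n k : ℝ) : ℝ) : ℂ) * _)
    (by simp +contextual)]
  simp [lowerFamily, mul_left_comm]

theorem hasSum_inner_lowerFamily_self_iff {a : ℂ} :
    HasSum (fun n => inner ℂ (lowerFamily k v n) (v n)) a ↔
      HasSum (fun n => inner ℂ (v n) (raiseFamily k v n)) a := by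
  rw [← hasSum_shift_iff (k := k) (f := fun n => inner ℂ (v n) (raiseFamily k v n))
    (by simp +contextual [raiseFamily])]
  simp [lowerFamily, raiseFamily]

theorem hasSum_inner_raiseFamily {a t : ℂ}
    (h : HasSum (fun n => inner ℂ (lowerFamily k v n) (lowerFamily k' v n)) a)
    (ht : HasSum (fun n => inner ℂ (v n) (v n)) t) :
    HasSum (fun n => inner ℂ (raiseFamily k' v n) (raiseFamily k v n))
      (a + if k = k' then t else 0) := by
  rw [hasSum_inner_lowerFamily_iff] at h
  rw [← hasSum_shift_iff (k := k') (by simp +contextual [raiseFamily])]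
  rcases eq_or_ne k k' with rfl | hk
  · rw [if_pos rfl]
    convert! h.add ht using 1
    ext n
    simp only [raiseFamily, Pi.add_apply, Pi.single_eq_same, inner_smul_left, inner_smul_right,
      add_tsub_cancel_right, Complex.conj_ofReal, Pi.sub_apply]
    rcases eq_or_ne (n k) 0 with h0 | h0
    · simp [h0]
    · rw [sub_add_single h0]
      have h1 : ((n k - 1 : ℕ) : ℝ) + 1 = n k := by
        rw [Nat.cast_sub (Nat.one_le_iff_ne_zero.2 h0)]; simp
      rw [h1, ← mul_assoc, ← mul_assoc, ← Complex.ofReal_mul, ← Complex.ofReal_mul,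
        Real.mul_self_sqrt (by positivity), Real.mul_self_sqrt (by positivity)]
      push_cast
      ring
  · rw [if_neg hk, add_zero]
    convert! h using 1
    ext n
    simp only [raiseFamily, Pi.add_apply, Pi.single_eq_same, inner_smul_left, inner_smul_right,
      add_tsub_cancel_right, Complex.conj_ofReal, Pi.sub_apply, Pi.single_eq_of_ne hk,
      Pi.single_eq_of_ne hk.symm, add_zero, tsub_zero]
    rcases eq_or_ne (n k) 0 with h0 | h0
    · simp [h0]
    · have h1 : n + Pi.single k' 1 - Pi.single k 1 = n - Pi.single k 1 + Pi.single k' 1 := by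
        conv_lhs => rw [← sub_add_single h0, add_right_comm, add_tsub_cancel_right]
      rw [h1]
      push_cast
      ring

theorem coherentCoeff_add_single (β : Fin N → ℂ) (n : Occ N) :
    coherentCoeff β (n + Pi.single k 1) * ((Real.sqrt ((n k : ℝ) + 1) : ℝ) : ℂ) =
      β k * coherentCoeff β n := by
  have h1 : (∏ j, (β j ^ (n + Pi.single k 1 : Occ N) j /
      ((Real.sqrt (((n + Pi.single k 1 : Occ N) j).factorial : ℝ) : ℝ) : ℂ))) =
      (∏ j, (β j ^ n j / ((Real.sqrt ((n j).factorial : ℝ) : ℝ) : ℂ))) *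
        (β k / ((Real.sqrt ((n k : ℝ) + 1) : ℝ) : ℂ)) := by
    rw [← Finset.mul_prod_erase _ _ (Finset.mem_univ k),
      ← Finset.mul_prod_erase _ (fun j => _ / _) (Finset.mem_univ k), mul_right_comm]
    congr 1
    · simp only [Pi.add_apply, Pi.single_eq_same, Nat.factorial_succ]
      push_cast
      rw [Real.sqrt_mul (by positivity), pow_succ]
      push_cast
      rw [mul_comm ((Real.sqrt ((n k : ℝ) + 1) : ℝ) : ℂ), mul_div_mul_comm]
    · refine Finset.prod_congr rfl fun j hj => ?_
      simp [Pi.single_eq_of_ne (Finset.ne_of_mem_erase hj)]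
  have h2 : ((Real.sqrt ((n k : ℝ) + 1) : ℝ) : ℂ) ≠ 0 := by
    exact_mod_cast (Real.sqrt_pos.2 (by positivity)).ne'
  rw [coherentCoeff, coherentCoeff, h1]
  field_simp

theorem bargmann_raiseFamily (β : Fin N → ℂ) :
    bargmann (raiseFamily k v) β = β k • bargmann v β := by
  rw [bargmann, bargmann, ← tsum_shift (k := k) (by simp +contextual [raiseFamily]),
    ← tsum_const_smul'']
  refine tsum_congr fun n => ?_
  rw [raiseFamily, smul_smul, smul_smul, ← coherentCoeff_add_single]
  simp

theorem bargmann_smul_pow (c : ℝ) (β : Fin N → ℂ) :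
    bargmann (fun n => ((c ^ (∑ j, n j) : ℝ) : ℂ) • v n) β =
      ((Real.exp (-((1 - c ^ 2) * (∑ j, ‖β j‖ ^ 2)) / 2) : ℝ) : ℂ) • bargmann v (c • β) := by
  rw [bargmann, bargmann, ← tsum_const_smul'']
  refine tsum_congr fun n => ?_
  rw [smul_smul, smul_smul, coherentCoeff, coherentCoeff, ← mul_assoc, ← Complex.ofReal_mul,
    ← Real.exp_add]
  congr 1
  have h1 : -((1 - c ^ 2) * ∑ j, ‖β j‖ ^ 2) / 2 + -(∑ j, ‖(c • β) j‖ ^ 2) / 2 =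
      -(∑ j, ‖β j‖ ^ 2) / 2 := by
    simp only [Pi.smul_apply, norm_smul, mul_pow, Real.norm_eq_abs, sq_abs, ← Finset.mul_sum]
    ring
  rw [h1, mul_assoc]
  congr 1
  rw [← Finset.prod_pow_eq_pow_sum, Complex.ofReal_prod, ← Finset.prod_mul_distrib]
  refine Finset.prod_congr rfl fun j _ => ?_
  simp [mul_pow]
  ring

variable [CompleteSpace H]

theorem hasSum_norm_sq_bargmann (hv : Memℓp (E := fun _ => H) v 2) :
    HasSum (fun n => ‖v n‖ ^ 2) (∫ β, ‖bargmann v β‖ ^ 2 ∂phaseMeasure N) := by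
  have h := integral_inner_bargmann hv hv
  simp_rw [inner_self_eq_norm_sq_to_K] at h
  rw [← RCLike.hasSum_ofReal ℂ, ← integral_ofReal]
  simpa using h

theorem integral_sq_norm_raise_smul_pow_le (hv : Memℓp (E := fun _ => H) v 2)
    (hint : Integrable (fun β => ‖β k‖ ^ 2 * ‖bargmann v β‖ ^ 2) (phaseMeasure N))
    {c : ℝ} (hc0 : 0 < c) (hc1 : c < 1) (s : Finset (Occ N)) :
    ∑ n ∈ s, ((n k : ℝ) + 1) * ((c ^ (∑ j, n j)) ^ 2 * ‖v n‖ ^ 2) ≤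
      (c ^ 2)⁻¹ * ((c ^ Module.finrank ℝ (Fin N → ℂ))⁻¹ *
        ∫ β, ‖β k‖ ^ 2 * ‖bargmann v β‖ ^ 2 ∂phaseMeasure N) := by
  set u : Occ N → H := fun n => ((c ^ (∑ j, n j) : ℝ) : ℂ) • v n with hu
  have hun (n : Occ N) : ‖u n‖ ^ 2 = (c ^ (∑ j, n j)) ^ 2 * ‖v n‖ ^ 2 := by
    rw [hu, norm_smul, mul_pow, Complex.norm_real, Real.norm_eq_abs, sq_abs]
  have hpow (n : Occ N) : (c ^ (∑ j, n j)) ^ 2 ≤ c ^ n k := by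
    rw [← pow_mul]
    refine pow_le_pow_of_le_one hc0.le hc1.le ?_
    have := Finset.single_le_sum (f := n) (fun _ _ => Nat.zero_le _) (Finset.mem_univ k)
    lia
  have hu2 : Memℓp (E := fun _ => H) u 2 := by
    refine memℓp_two_iff.2 ((memℓp_two_iff.1 hv).of_nonneg_of_le (fun _ => by positivity) ?_)
    intro n
    rw [hun]
    exact mul_le_of_le_one_left (by positivity)
      ((hpow n).trans (pow_le_one₀ hc0.le hc1.le))
  obtain ⟨C, hC⟩ := (tendsto_self_mul_const_pow_of_lt_one hc0.le hc1).bddAbove_range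
  have hnum : Summable fun n : Occ N => (n k : ℝ) * ‖u n‖ ^ 2 := by
    refine ((memℓp_two_iff.1 hv).mul_left C).of_nonneg_of_le (fun _ => by positivity) ?_
    intro n
    rw [hun, ← mul_assoc]
    gcongr
    exact (mul_le_mul_of_nonneg_left (hpow n) (by positivity)).trans (hC ⟨n k, rfl⟩)
  have hr := memℓp_raiseFamily hu2 hnum
  have h1 := hasSum_norm_sq_bargmann hr
  rw [← hasSum_shift_iff (k := k) (by simp +contextual [raiseFamily])] at h1
  have h2 := sum_le_hasSum s (fun _ _ => by positivity) h1
  simp only [norm_sq_raiseFamily, add_tsub_cancel_right, Pi.add_apply, Pi.single_eq_same, hun,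
    Nat.cast_add, Nat.cast_one] at h2
  refine h2.trans ?_
  let g : (Fin N → ℂ) → ℝ := fun β => ‖β k‖ ^ 2 * ‖bargmann v β‖ ^ 2
  have hg : Integrable (fun β => g (c • β)) :=
    (integrable_phaseMeasure.1 hint).comp_smul hc0.ne'
  have h3 : ∫ β, (c ^ 2)⁻¹ * g (c • β) ∂phaseMeasure N = (c ^ 2)⁻¹ *
      ((c ^ Module.finrank ℝ (Fin N → ℂ))⁻¹ *
        ∫ β, ‖β k‖ ^ 2 * ‖bargmann v β‖ ^ 2 ∂phaseMeasure N) := by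
    rw [integral_const_mul, integral_phaseMeasure, integral_phaseMeasure,
      Measure.integral_comp_smul, abs_of_pos (by positivity)]
    simp only [g, smul_eq_mul]
    ring
  rw [← h3]
  refine integral_mono ?_ ((integrable_phaseMeasure.2 hg).const_mul _) fun β => ?_
  · exact (memLp_two_iff_integrable_sq_norm (memLp_bargmann hr).1).1 (memLp_bargmann hr)
  · have h5 : ‖bargmann u β‖ ≤ ‖bargmann v (c • β)‖ := by
      rw [hu, bargmann_smul_pow, norm_smul, Complex.norm_real, Real.norm_eq_abs, Real.abs_exp]
      refine mul_le_of_le_one_left (norm_nonneg _) (Real.exp_le_one_iff.2 ?_)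
      have : c ^ 2 ≤ 1 := pow_le_one₀ hc0.le hc1.le
      have : 0 ≤ (1 - c ^ 2) * ∑ j, ‖β j‖ ^ 2 := mul_nonneg (by linarith) (by positivity)
      linarith
    simp only [g, bargmann_raiseFamily, norm_smul, Pi.smul_apply, mul_pow, Real.norm_eq_abs,
      sq_abs]
    rw [mul_assoc, inv_mul_cancel_left₀ (by positivity)]
    gcongr

theorem summable_of_integrable_bargmann (hv : Memℓp (E := fun _ => H) v 2)
    (hint : Integrable (fun β => ‖β k‖ ^ 2 * ‖bargmann v β‖ ^ 2) (phaseMeasure N)) :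
    Summable fun n : Occ N => (n k : ℝ) * ‖v n‖ ^ 2 := by
  refine Summable.of_nonneg_of_le (fun _ => by positivity)
    (fun n => mul_le_mul_of_nonneg_right (le_add_of_nonneg_right zero_le_one) (sq_nonneg ‖v n‖)) ?_
  refine summable_of_sum_le (fun _ => by positivity)
    (c := ∫ β, ‖β k‖ ^ 2 * ‖bargmann v β‖ ^ 2 ∂phaseMeasure N) fun s => ?_
  let L : ℝ → ℝ := fun c => ∑ n ∈ s, ((n k : ℝ) + 1) * ((c ^ (∑ j, n j)) ^ 2 * ‖v n‖ ^ 2)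
  let R : ℝ → ℝ := fun c => (c ^ 2)⁻¹ * ((c ^ Module.finrank ℝ (Fin N → ℂ))⁻¹ *
        ∫ β, ‖β k‖ ^ 2 * ‖bargmann v β‖ ^ 2 ∂phaseMeasure N)
  have hL : ContinuousAt L 1 := by fun_prop
  have hR : ContinuousAt R 1 := by
    refine .mul (.inv₀ (by fun_prop) (by simp)) (.mul (.inv₀ (by fun_prop) (by simp)) (by fun_prop))
  have h := le_of_tendsto_of_tendsto (b := nhdsWithin 1 (Set.Iio 1))
    (hL.tendsto.mono_left nhdsWithin_le_nhds)
    (hR.tendsto.mono_left nhdsWithin_le_nhds) (by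
      filter_upwards [Ioo_mem_nhdsLT (zero_lt_one (α := ℝ))] with c hc
      exact integral_sq_norm_raise_smul_pow_le hv hint hc.1 hc.2 s)
  simpa [L, R] using h

end Ladder

section Moments

variable {N : ℕ} {ρ : FockSpace N →L[ℂ] FockSpace N}

section Sqrt

variable {H : Type*} [NormedAddCommGroup H] [InnerProductSpace ℂ H] [CompleteSpace H]

/-- The square root of a positive bounded operator. -/
def sqrtOperator (T : H →L[ℂ] H) : H →L[ℂ] H := CFC.sqrt T

theorem inner_sqrtOperator {T : H →L[ℂ] H} (hT : T.IsPositive) (x y : H) :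
    inner ℂ (sqrtOperator T x) (sqrtOperator T y) = inner ℂ x (T y) := by
  have h1 : (sqrtOperator T).IsPositive :=
    (ContinuousLinearMap.nonneg_iff_isPositive _).1 (CFC.sqrt_nonneg T)
  have h2 : sqrtOperator T * sqrtOperator T = T :=
    CFC.sqrt_mul_sqrt_self T ((ContinuousLinearMap.nonneg_iff_isPositive _).2 hT)
  rw [h1.inner_left_eq_inner_right]
  exact congrArg (inner ℂ x) (DFunLike.congr_fun h2 y)

end Sqrt

/-- The images of the number states under the square root of `ρ`. -/
def amplitude (ρ : FockSpace N →L[ℂ] FockSpace N) (n : Occ N) : FockSpace N :=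
  sqrtOperator ρ (numberState n)

theorem inner_amplitude (hρ : ρ.IsPositive) (m n : Occ N) :
    inner ℂ (amplitude ρ m) (amplitude ρ n) = inner ℂ (numberState m) (ρ (numberState n)) :=
  inner_sqrtOperator hρ _ _

theorem IsDensityOperator.hasSum_inner_amplitude (hρ : IsDensityOperator ρ) :
    HasSum (fun n => inner ℂ (amplitude ρ n) (amplitude ρ n)) 1 := by
  simpa only [inner_amplitude hρ.isPositive] using hρ.trace_one

theorem IsDensityOperator.memℓp_amplitude (hρ : IsDensityOperator ρ) :
    Memℓp (E := fun _ => FockSpace N) (amplitude ρ) 2 := by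
  refine memℓp_two_iff.2 ?_
  have h := hρ.hasSum_inner_amplitude.summable
  simp_rw [inner_self_eq_norm_sq_to_K] at h
  rw [← RCLike.summable_ofReal ℂ]
  simpa using h

theorem hasSum_numberState (x : FockSpace N) : HasSum (fun n => x n • numberState n) x := by
  convert! lp.hasSum_single (by norm_num) x using 1
  ext1 n
  rw [numberState, ← lp.single_smul]
  simp

theorem husimiQ_eq (hρ : ρ.IsPositive) (β : Fin N → ℂ) :
    husimiQ ρ β = ‖bargmann (amplitude ρ) β‖ ^ 2 := by
  have h := (hasSum_numberState (coherentState β)).mapL (sqrtOperator ρ)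
  have h2 : bargmann (amplitude ρ) β = sqrtOperator ρ (coherentState β) := by
    rw [← h.tsum_eq]
    simp only [map_smul]
    rfl
  rw [husimiQ, ← inner_sqrtOperator hρ, h2, inner_self_eq_norm_sq_to_K]
  norm_cast

theorem toFock_single (n : Occ N) (c : ℂ) :
    toFock N (Finsupp.single n c) = c • numberState n := by
  simp [toFock]

theorem hasExpectation_annihilation_iff (hρ : ρ.IsPositive) {k : Fin N} {a : ℂ} :
    HasExpectation ρ (annihilation k) a ↔
      HasSum (fun n => inner ℂ (amplitude ρ n) (raiseFamily k (amplitude ρ) n)) a := by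
  simp only [HasExpectation, annihilation, toFock_single, raiseFamily, inner_smul_right,
    inner_amplitude hρ, Finsupp.linearCombination_single, one_smul, map_smul]

theorem hasExpectation_number_iff (hρ : ρ.IsPositive) {k k' : Fin N} {a : ℂ} :
    HasExpectation ρ (creation k' ∘ₗ annihilation k) a ↔
      HasSum (fun n => inner ℂ (lowerFamily k (amplitude ρ) n)
        (lowerFamily k' (amplitude ρ) n)) a := by
  rw [hasSum_inner_lowerFamily_iff]
  simp only [HasExpectation, annihilation, creation, toFock_single, inner_smul_right,
    inner_amplitude hρ, Finsupp.linearCombination_single, one_smul, map_smul, LinearMap.comp_apply]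

variable {r : Matrix (Fin N) (Fin N) ℂ} {α : Fin N → ℂ}

theorem HasRSF.memℓp_lowerFamily (h : HasRSF ρ r α) (hρ : IsDensityOperator ρ) (k : Fin N) :
    Memℓp (E := fun _ => FockSpace N) (lowerFamily k (amplitude ρ)) 2 := by
  have h := ((hasExpectation_number_iff hρ.isPositive).1 (h.singleParticle k k)).summable
  simp_rw [inner_self_eq_norm_sq_to_K] at h
  rw [memℓp_two_iff, ← RCLike.summable_ofReal ℂ]
  simpa using h

theorem HasRSF.memℓp_raiseFamily (h : HasRSF ρ r α) (hρ : IsDensityOperator ρ) (k : Fin N) :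
    Memℓp (E := fun _ => FockSpace N) (raiseFamily k (amplitude ρ)) 2 :=
  BosonField.memℓp_raiseFamily hρ.memℓp_amplitude
    (memℓp_lowerFamily_iff.1 (h.memℓp_lowerFamily hρ k))

theorem correlationMatrix_posSemidef (hρ : IsDensityOperator ρ) (h : HasRSF ρ r α) :
    (correlationMatrix r α).PosSemidef := by
  let F := lp (fun _ : Occ N => FockSpace N) 2
  let v : F := ⟨amplitude ρ, hρ.memℓp_amplitude⟩
  let w : Fin N → F := fun k => ⟨lowerFamily k (amplitude ρ), h.memℓp_lowerFamily hρ k⟩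
  have h1 : inner ℂ v v = (1 : ℂ) :=
    (lp.hasSum_inner (𝕜 := ℂ) v v).unique hρ.hasSum_inner_amplitude
  have h2 (k : Fin N) : inner ℂ (w k) v = α k :=
    (lp.hasSum_inner (𝕜 := ℂ) (w k) v).unique (hasSum_inner_lowerFamily_self_iff.2
      ((hasExpectation_annihilation_iff hρ.isPositive).1 (h.averagedField k)))
  have h2' (k : Fin N) : inner ℂ v (w k) = star (α k) := by
    rw [← h2, ← inner_conj_symm]; rfl
  have h3 (k k' : Fin N) : inner ℂ (w k) (w k') = r k k' :=
    (lp.hasSum_inner (𝕜 := ℂ) (w k) (w k')).unique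
      ((hasExpectation_number_iff hρ.isPositive).1 (h.singleParticle k k'))
  have h4 : correlationMatrix r α = Matrix.gram ℂ fun k => w k - star (α k) • v := by
    ext k k'
    rw [Matrix.gram_apply, inner_sub_left, inner_sub_right, inner_sub_right, inner_smul_left,
      inner_smul_left, inner_smul_right, inner_smul_right, h1, h2, h2', h3, correlationMatrix,
      Matrix.sub_apply, Matrix.vecMulVec_apply, starRingEnd_apply, star_star, Pi.star_apply]
    ring
  rw [h4]
  exact Matrix.posSemidef_gram ℂ _

theorem IsDensityOperator.integrable_husimiQ (hρ : IsDensityOperator ρ) :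
    Integrable (husimiQ ρ) (phaseMeasure N) := by
  have h := memLp_bargmann hρ.memℓp_amplitude
  refine ((memLp_two_iff_integrable_sq_norm h.1).1 h).congr (.of_forall fun β => ?_)
  exact (husimiQ_eq hρ.isPositive β).symm

theorem IsDensityOperator.integral_husimiQ (hρ : IsDensityOperator ρ) :
    ∫ β, husimiQ ρ β ∂phaseMeasure N = 1 := by
  have h := (integral_inner_bargmann hρ.memℓp_amplitude hρ.memℓp_amplitude).unique
    hρ.hasSum_inner_amplitude
  simp_rw [inner_self_eq_norm_sq_to_K] at h
  simp_rw [husimiQ_eq hρ.isPositive]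
  rw [← Complex.ofReal_inj, ← integral_complex_ofReal]
  simpa using h

theorem inner_bargmann_raiseFamily_raiseFamily (hρ : ρ.IsPositive) (k k' : Fin N) (β : Fin N → ℂ) :
    inner ℂ (bargmann (raiseFamily k' (amplitude ρ)) β) (bargmann (raiseFamily k (amplitude ρ)) β)
      = β k * star (β k') * (husimiQ ρ β : ℂ) := by
  rw [bargmann_raiseFamily, bargmann_raiseFamily, inner_smul_left, inner_smul_right,
    inner_self_eq_norm_sq_to_K, husimiQ_eq hρ, starRingEnd_apply]
  push_cast
  simp only [Complex.coe_algebraMap]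
  ring

theorem inner_bargmann_raiseFamily (hρ : ρ.IsPositive) (k : Fin N) (β : Fin N → ℂ) :
    inner ℂ (bargmann (amplitude ρ) β) (bargmann (raiseFamily k (amplitude ρ)) β)
      = β k * (husimiQ ρ β : ℂ) := by
  rw [bargmann_raiseFamily, inner_smul_right, inner_self_eq_norm_sq_to_K, husimiQ_eq hρ]
  push_cast
  rfl

theorem HasRSF.integrable_first (h : HasRSF ρ r α) (hρ : IsDensityOperator ρ) (k : Fin N) :
    Integrable (fun β => β k * (husimiQ ρ β : ℂ)) (phaseMeasure N) :=
  (integrable_inner_bargmann hρ.memℓp_amplitude (h.memℓp_raiseFamily hρ k)).congr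
    (.of_forall fun β => inner_bargmann_raiseFamily hρ.isPositive k β)

theorem HasRSF.integral_first (h : HasRSF ρ r α) (hρ : IsDensityOperator ρ) (k : Fin N) :
    ∫ β, β k * (husimiQ ρ β : ℂ) ∂phaseMeasure N = α k := by
  have h1 := (integral_inner_bargmann hρ.memℓp_amplitude (h.memℓp_raiseFamily hρ k)).unique
    ((hasExpectation_annihilation_iff hρ.isPositive).1 (h.averagedField k))
  simpa only [inner_bargmann_raiseFamily hρ.isPositive] using h1

theorem HasRSF.integrable_second (h : HasRSF ρ r α) (hρ : IsDensityOperator ρ) (k k' : Fin N) :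
    Integrable (fun β => β k * star (β k') * (husimiQ ρ β : ℂ)) (phaseMeasure N) :=
  (integrable_inner_bargmann (h.memℓp_raiseFamily hρ k') (h.memℓp_raiseFamily hρ k)).congr
    (.of_forall fun β => inner_bargmann_raiseFamily_raiseFamily hρ.isPositive k k' β)

theorem HasRSF.integral_second (h : HasRSF ρ r α) (hρ : IsDensityOperator ρ) (k k' : Fin N) :
    ∫ β, β k * star (β k') * (husimiQ ρ β : ℂ) ∂phaseMeasure N =
      (r + 1 : Matrix (Fin N) (Fin N) ℂ) k k' := by
  have h1 := (integral_inner_bargmann (h.memℓp_raiseFamily hρ k')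
    (h.memℓp_raiseFamily hρ k)).unique
    (hasSum_inner_raiseFamily ((hasExpectation_number_iff hρ.isPositive).1 (h.singleParticle k k'))
      hρ.hasSum_inner_amplitude)
  simpa only [inner_bargmann_raiseFamily_raiseFamily hρ.isPositive, Matrix.add_apply, Matrix.one_apply] using h1

theorem exists_hasRSF (hρ : IsDensityOperator ρ)
    (h : ∀ k, Integrable (fun β => ‖β k‖ ^ 2 * husimiQ ρ β) (phaseMeasure N)) :
    ∃ r α, HasRSF ρ r α := by
  have h1 (k : Fin N) := summable_of_integrable_bargmann (k := k) hρ.memℓp_amplitude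
    (by simpa only [husimiQ_eq hρ.isPositive] using h k)
  let F := lp (fun _ : Occ N => FockSpace N) 2
  let w : Fin N → F := fun k => ⟨_, memℓp_lowerFamily_iff.2 (h1 k)⟩
  let u : Fin N → F := fun k => ⟨_, memℓp_raiseFamily hρ.memℓp_amplitude (h1 k)⟩
  let v : F := ⟨amplitude ρ, hρ.memℓp_amplitude⟩
  exact ⟨.of fun k k' => inner ℂ (w k) (w k'), fun k => inner ℂ v (u k),
    fun k k' => (hasExpectation_number_iff hρ.isPositive).2 (lp.hasSum_inner (𝕜 := ℂ) (w k) (w k')),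
    fun k => (hasExpectation_annihilation_iff hρ.isPositive).2
      (lp.hasSum_inner (𝕜 := ℂ) v (u k))⟩

end Moments

section Gaussian

variable {N : ℕ}

theorem map_mulVec_phaseMeasure {L : Matrix (Fin N) (Fin N) ℂ} (hL : L.det ≠ 0) :
    (phaseMeasure N).map (fun z => L.mulVec z) =
      ENNReal.ofReal ((Complex.normSq L.det)⁻¹) • phaseMeasure N := by
  let f : (Fin N → ℂ) →ₗ[ℝ] (Fin N → ℂ) := (Matrix.toLin' L).restrictScalars ℝ
  have hdet : LinearMap.det f = Complex.normSq L.det := by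
    rw [LinearMap.det_restrictScalars, LinearMap.det_toLin', Algebra.norm_complex_apply]
  have hf : LinearMap.det f ≠ 0 := by
    rw [hdet]
    simpa using hL
  have h := Measure.map_linearMap_addHaar_eq_smul_addHaar (volume : Measure (Fin N → ℂ)) hf
  rw [hdet, abs_of_nonneg (inv_nonneg.2 (Complex.normSq_nonneg _))] at h
  rw [phaseMeasure, Measure.map_smul, smul_comm, ← h]
  rfl

theorem measurableEmbedding_mulVec {L : Matrix (Fin N) (Fin N) ℂ} (hL : L.det ≠ 0) :
    MeasurableEmbedding fun z : Fin N → ℂ => L.mulVec z :=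
  Continuous.measurableEmbedding (by fun_prop)
    (Matrix.mulVec_injective_of_isUnit ((Matrix.isUnit_iff_isUnit_det L).2 hL.isUnit))

instance (N : ℕ) : (phaseMeasure N).IsAddRightInvariant := by
  unfold phaseMeasure; infer_instance

section Affine

variable {E : Type*} [NormedAddCommGroup E] {L : Matrix (Fin N) (Fin N) ℂ}
  {g : (Fin N → ℂ) → E}

theorem integral_comp_affine [NormedSpace ℝ E] (hL : L.det ≠ 0) (α : Fin N → ℂ) :
    ∫ z, g (L.mulVec z + α) ∂phaseMeasure N =
      (Complex.normSq L.det)⁻¹ • ∫ β, g β ∂phaseMeasure N := by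
  rw [← (measurableEmbedding_mulVec hL).integral_map (fun β => g (β + α)),
    map_mulVec_phaseMeasure hL, integral_smul_measure, integral_add_right_eq_self,
    ENNReal.toReal_ofReal (inv_nonneg.2 (Complex.normSq_nonneg _))]

theorem integrable_comp_affine (hL : L.det ≠ 0) (α : Fin N → ℂ) :
    Integrable (fun z => g (L.mulVec z + α)) (phaseMeasure N) ↔
      Integrable g (phaseMeasure N) := by
  have h : Integrable (fun β => g (β + α)) (phaseMeasure N) ↔ Integrable g (phaseMeasure N) := by
    refine ⟨fun h => ?_, fun h => h.comp_add_right α⟩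
    simpa using h.comp_add_right (-α)
  rw [← h, ← integrable_smul_measure (μ := phaseMeasure N) (f := fun β => g (β + α))
    (c := ENNReal.ofReal ((Complex.normSq L.det)⁻¹)) (by simpa using hL) (by simp),
    ← map_mulVec_phaseMeasure hL]
  exact ((measurableEmbedding_mulVec hL).integrable_map_iff (g := fun β => g (β + α))).symm

end Affine

/-- The Gaussian density with mean `α` and covariance `M` with respect to `phaseMeasure`. -/
def gaussianWeight (M : Matrix (Fin N) (Fin N) ℂ) (α β : Fin N → ℂ) : ℝ :=
  M.det.re⁻¹ * Real.exp (-(star (β - α) ⬝ᵥ (M⁻¹).mulVec (β - α)).re)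

/-- The standard Gaussian density with respect to `phaseMeasure`. -/
def stdGaussian (z : Fin N → ℂ) : ℝ := Real.exp (-∑ k, ‖z k‖ ^ 2)

theorem star_dotProduct_self_re (z : Fin N → ℂ) : (star z ⬝ᵥ z).re = ∑ k, ‖z k‖ ^ 2 := by
  simp only [dotProduct, Complex.re_sum, Pi.star_apply]
  refine Finset.sum_congr rfl fun k _ => ?_
  rw [← starRingEnd_apply, ← Complex.normSq_eq_conj_mul_self, Complex.ofReal_re,
    Complex.normSq_eq_norm_sq]

open scoped MatrixOrder Matrix.Norms.L2Operator in
theorem exists_eq_mul_conjTranspose {M : Matrix (Fin N) (Fin N) ℂ} (hM : M.PosDef) :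
    ∃ L : Matrix (Fin N) (Fin N) ℂ, L.det ≠ 0 ∧ M = L * L.conjTranspose := by
  obtain ⟨B, hB⟩ := CStarAlgebra.nonneg_iff_eq_star_mul_self.mp hM.posSemidef.nonneg
  rw [Matrix.star_eq_conjTranspose] at hB
  refine ⟨B.conjTranspose, fun h => hM.det_pos.ne' ?_, by simpa using hB⟩
  rw [hB, Matrix.det_mul, h, zero_mul]

section Weight

variable {L : Matrix (Fin N) (Fin N) ℂ}

theorem gaussianWeight_comp_affine (hL : L.det ≠ 0) (α z : Fin N → ℂ) :
    gaussianWeight (L * L.conjTranspose) α (L.mulVec z + α) =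
      (Complex.normSq L.det)⁻¹ * stdGaussian z := by
  have h1 : (L * L.conjTranspose).det.re = Complex.normSq L.det := by
    rw [Matrix.det_mul, Matrix.det_conjTranspose, ← starRingEnd_apply, Complex.mul_conj,
      Complex.ofReal_re]
  have hu : IsUnit L.det := hL.isUnit
  have h2 : star (L.mulVec z) ⬝ᵥ ((L * L.conjTranspose)⁻¹).mulVec (L.mulVec z) = star z ⬝ᵥ z := by
    rw [Matrix.star_mulVec, ← Matrix.dotProduct_mulVec, Matrix.mulVec_mulVec,
      Matrix.mulVec_mulVec, Matrix.mul_inv_rev, ← mul_assoc, Matrix.mul_nonsing_inv _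
      (by rw [Matrix.det_conjTranspose]; exact hu.star), one_mul, Matrix.nonsing_inv_mul _ hu,
      Matrix.one_mulVec]
  rw [gaussianWeight, add_sub_cancel_right, h1, h2, star_dotProduct_self_re, stdGaussian]

variable {E : Type*} [NormedAddCommGroup E] [NormedSpace ℝ E] (f : (Fin N → ℂ) → E)

theorem integral_gaussianWeight_smul (hL : L.det ≠ 0) (α : Fin N → ℂ) :
    ∫ β, gaussianWeight (L * L.conjTranspose) α β • f β ∂phaseMeasure N =
      ∫ z, stdGaussian z • f (L.mulVec z + α) ∂phaseMeasure N := by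
  have h := integral_comp_affine
    (g := fun β => gaussianWeight (L * L.conjTranspose) α β • f β) hL α
  simp only [gaussianWeight_comp_affine hL, mul_smul] at h
  rw [integral_smul] at h
  exact (smul_right_injective E (by simpa using hL) h).symm

theorem integrable_gaussianWeight_smul (hL : L.det ≠ 0) (α : Fin N → ℂ) :
    Integrable (fun β => gaussianWeight (L * L.conjTranspose) α β • f β) (phaseMeasure N) ↔
      Integrable (fun z => stdGaussian z • f (L.mulVec z + α)) (phaseMeasure N) := by
  rw [← integrable_comp_affine hL α]
  simp only [gaussianWeight_comp_affine hL, mul_smul]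
  rw [integrable_fun_smul_iff (by simpa using hL)]

end Weight

section Moments

theorem stdGaussian_eq (z : Fin N → ℂ) :
    (stdGaussian z : ℂ) = star (coherentCoeff z 0) * coherentCoeff z 0 := by
  simp only [coherentCoeff, Pi.zero_apply, pow_zero, Nat.factorial_zero, Nat.cast_one,
    Real.sqrt_one, Complex.ofReal_one, div_one, Finset.prod_const_one, mul_one]
  rw [← starRingEnd_apply, Complex.conj_ofReal, ← Complex.ofReal_mul, ← Real.exp_add, stdGaussian]
  ring_nf

theorem coherentCoeff_single (z : Fin N → ℂ) (k : Fin N) :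
    coherentCoeff z (Pi.single k 1) = z k * coherentCoeff z 0 := by
  simpa using coherentCoeff_add_single (k := k) z 0

theorem integrable_star_mul_coherentCoeff (m n : Occ N) :
    Integrable (fun z => star (coherentCoeff z m) * coherentCoeff z n) (phaseMeasure N) :=
  (memLp_coherentCoeff m).star.integrable_mul (memLp_coherentCoeff n)

theorem integrable_stdGaussian : Integrable (stdGaussian (N := N)) (phaseMeasure N) := by
  refine (integrable_star_mul_coherentCoeff 0 0).re.congr (.of_forall fun z => ?_)
  simp only [← stdGaussian_eq]
  exact Complex.ofReal_re _

theorem integral_stdGaussian : ∫ z, stdGaussian (N := N) z ∂phaseMeasure N = 1 := by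
  rw [← Complex.ofReal_inj, ← integral_complex_ofReal]
  simp_rw [stdGaussian_eq]
  rw [integral_coherentCoeff]
  simp

theorem stdGaussian_smul_apply (z : Fin N → ℂ) (k : Fin N) :
    stdGaussian z • z k = star (coherentCoeff z 0) * coherentCoeff z (Pi.single k 1) := by
  rw [← Complex.coe_smul, stdGaussian_eq, coherentCoeff_single, smul_eq_mul]
  ring

theorem stdGaussian_smul_mul (z : Fin N → ℂ) (k j : Fin N) :
    stdGaussian z • (z k * star (z j)) =
      star (coherentCoeff z (Pi.single j 1)) * coherentCoeff z (Pi.single k 1) := by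
  rw [← Complex.coe_smul, stdGaussian_eq, coherentCoeff_single, coherentCoeff_single,
    smul_eq_mul, star_mul']
  ring

theorem integrable_stdGaussian_smul_apply (k : Fin N) :
    Integrable (fun z : Fin N → ℂ => stdGaussian z • z k) (phaseMeasure N) := by
  simp_rw [stdGaussian_smul_apply]
  exact integrable_star_mul_coherentCoeff _ _

theorem integral_stdGaussian_smul_apply (k : Fin N) :
    ∫ z : Fin N → ℂ, stdGaussian z • z k ∂phaseMeasure N = 0 := by
  simp_rw [stdGaussian_smul_apply]
  rw [integral_coherentCoeff, if_neg]
  intro h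
  simpa using congrFun h k

theorem integrable_stdGaussian_smul_mul (k j : Fin N) :
    Integrable (fun z : Fin N → ℂ => stdGaussian z • (z k * star (z j))) (phaseMeasure N) := by
  simp_rw [stdGaussian_smul_mul]
  exact integrable_star_mul_coherentCoeff _ _

theorem integral_stdGaussian_smul_mul (k j : Fin N) :
    ∫ z : Fin N → ℂ, stdGaussian z • (z k * star (z j)) ∂phaseMeasure N =
      if j = k then 1 else 0 := by
  simp_rw [stdGaussian_smul_mul]
  rw [integral_coherentCoeff]
  refine if_congr ?_ rfl rfl
  constructor
  · intro h
    by_contra hjk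
    simpa [Pi.single_eq_of_ne hjk] using congrFun h j
  · rintro rfl
    rfl

variable {M : Matrix (Fin N) (Fin N) ℂ}

theorem integrable_gaussianWeight (hM : M.PosDef) (α : Fin N → ℂ) :
    Integrable (gaussianWeight M α) (phaseMeasure N) := by
  obtain ⟨L, hL, rfl⟩ := exists_eq_mul_conjTranspose hM
  have := (integrable_gaussianWeight_smul (fun _ => (1 : ℝ)) hL α).2
    (by simpa using integrable_stdGaussian)
  simpa using this

theorem integral_gaussianWeight (hM : M.PosDef) (α : Fin N → ℂ) :
    ∫ β, gaussianWeight M α β ∂phaseMeasure N = 1 := by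
  obtain ⟨L, hL, rfl⟩ := exists_eq_mul_conjTranspose hM
  have := integral_gaussianWeight_smul (fun _ => (1 : ℝ)) hL α
  simpa [integral_stdGaussian] using this

theorem mulVec_smul_eq_sum (L : Matrix (Fin N) (Fin N) ℂ) (z : Fin N → ℂ) (c : ℝ) (k : Fin N) :
    c • L.mulVec z k = ∑ i, L k i * (c • z i) := by
  simp [Matrix.mulVec, dotProduct, Finset.mul_sum, mul_left_comm]

theorem integrable_stdGaussian_smul_mulVec (L : Matrix (Fin N) (Fin N) ℂ) (k : Fin N) :
    Integrable (fun z : Fin N → ℂ => stdGaussian z • L.mulVec z k) (phaseMeasure N) := by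
  simp_rw [mulVec_smul_eq_sum]
  exact integrable_finsetSum _ fun i _ => (integrable_stdGaussian_smul_apply i).const_mul _

theorem integral_stdGaussian_smul_mulVec (L : Matrix (Fin N) (Fin N) ℂ) (k : Fin N) :
    ∫ z : Fin N → ℂ, stdGaussian z • L.mulVec z k ∂phaseMeasure N = 0 := by
  simp_rw [mulVec_smul_eq_sum]
  rw [integral_finsetSum _ fun i _ => (integrable_stdGaussian_smul_apply i).const_mul _]
  simp_rw [integral_const_mul, integral_stdGaussian_smul_apply, mul_zero, Finset.sum_const_zero]

theorem mulVec_mul_smul_eq_sum (L : Matrix (Fin N) (Fin N) ℂ) (z : Fin N → ℂ) (c : ℝ)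
    (k j : Fin N) : c • (L.mulVec z k * star (L.mulVec z j)) =
      ∑ i, ∑ l, L k i * star (L j l) * (c • (z i * star (z l))) := by
  simp only [Matrix.mulVec, dotProduct, star_sum, Finset.sum_mul_sum, Finset.smul_sum]
  refine Finset.sum_congr rfl fun i _ => Finset.sum_congr rfl fun l _ => ?_
  rw [mul_smul_comm, star_mul']
  congr 1
  ring

theorem integrable_stdGaussian_smul_mulVec_mul (L : Matrix (Fin N) (Fin N) ℂ) (k j : Fin N) :
    Integrable (fun z : Fin N → ℂ => stdGaussian z • (L.mulVec z k * star (L.mulVec z j)))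
      (phaseMeasure N) := by
  simp_rw [mulVec_mul_smul_eq_sum]
  exact integrable_finsetSum _ fun i _ => integrable_finsetSum _ fun l _ =>
    (integrable_stdGaussian_smul_mul i l).const_mul _

theorem integral_stdGaussian_smul_mulVec_mul (L : Matrix (Fin N) (Fin N) ℂ) (k j : Fin N) :
    ∫ z : Fin N → ℂ, stdGaussian z • (L.mulVec z k * star (L.mulVec z j)) ∂phaseMeasure N =
      (L * L.conjTranspose) k j := by
  simp_rw [mulVec_mul_smul_eq_sum]
  rw [integral_finsetSum _ fun i _ => integrable_finsetSum _ fun l _ =>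
    (integrable_stdGaussian_smul_mul i l).const_mul _]
  simp_rw [integral_finsetSum _ fun l _ => (integrable_stdGaussian_smul_mul _ l).const_mul _,
    integral_const_mul, integral_stdGaussian_smul_mul]
  simp [Matrix.mul_apply]

theorem integral_gaussianWeight_smul_apply (hM : M.PosDef) (α : Fin N → ℂ) (k : Fin N) :
    ∫ β, gaussianWeight M α β • β k ∂phaseMeasure N = α k := by
  obtain ⟨L, hL, rfl⟩ := exists_eq_mul_conjTranspose hM
  rw [integral_gaussianWeight_smul (fun β => β k) hL]
  simp_rw [Pi.add_apply, smul_add]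
  rw [integral_add (integrable_stdGaussian_smul_mulVec L k) (integrable_stdGaussian.smul_const _),
    integral_stdGaussian_smul_mulVec, integral_smul_const, integral_stdGaussian]
  simp

theorem smul_add_mul_star (c : ℝ) (x y a b : ℂ) :
    c • ((x + a) * star (y + b)) =
      c • (x * star y) + (c • x) * star b + a * star (c • y) + c • (a * star b) := by
  simp only [← Complex.coe_smul, smul_eq_mul, star_add, star_mul', Complex.star_def,
    Complex.conj_ofReal]
  ring

theorem integrable_gaussianWeight_smul_mul (hM : M.PosDef) (α : Fin N → ℂ) (k j : Fin N) :
    Integrable (fun β => gaussianWeight M α β • (β k * star (β j))) (phaseMeasure N) := by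
  obtain ⟨L, hL, rfl⟩ := exists_eq_mul_conjTranspose hM
  rw [integrable_gaussianWeight_smul (fun β => β k * star (β j)) hL]
  simp_rw [Pi.add_apply, smul_add_mul_star]
  exact (((integrable_stdGaussian_smul_mulVec_mul L k j).add
    ((integrable_stdGaussian_smul_mulVec L k).mul_const _)).add
    ((Complex.conjCLE.toContinuousLinearMap.integrable_comp
      (integrable_stdGaussian_smul_mulVec L j)).const_mul _)).add
    (integrable_stdGaussian.smul_const _)

theorem integral_gaussianWeight_smul_mul (hM : M.PosDef) (α : Fin N → ℂ) (k j : Fin N) :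
    ∫ β, gaussianWeight M α β • (β k * star (β j)) ∂phaseMeasure N =
      M k j + α k * star (α j) := by
  obtain ⟨L, hL, rfl⟩ := exists_eq_mul_conjTranspose hM
  rw [integral_gaussianWeight_smul (fun β => β k * star (β j)) hL]
  simp_rw [Pi.add_apply, smul_add_mul_star]
  have h1 := integrable_stdGaussian_smul_mulVec_mul L k j
  have h2 := (integrable_stdGaussian_smul_mulVec L k).mul_const (star (α j))
  have h3 : Integrable (fun z => α k * star (stdGaussian z • L.mulVec z j)) (phaseMeasure N) :=
    (Complex.conjCLE.toContinuousLinearMap.integrable_comp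
      (integrable_stdGaussian_smul_mulVec L j)).const_mul _
  have h4 : ∫ z, star (stdGaussian z • L.mulVec z j) ∂phaseMeasure N = 0 := by
    have := integral_conj (𝕜 := ℂ) (μ := phaseMeasure N)
      (f := fun z => stdGaussian z • L.mulVec z j)
    rw [integral_stdGaussian_smul_mulVec, map_zero] at this
    exact this
  have h12 : Integrable (fun z => stdGaussian z • (L.mulVec z k * star (L.mulVec z j)) +
      stdGaussian z • L.mulVec z k * star (α j)) (phaseMeasure N) := h1.add h2
  have h123 : Integrable (fun z => stdGaussian z • (L.mulVec z k * star (L.mulVec z j)) +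
      stdGaussian z • L.mulVec z k * star (α j) + α k * star (stdGaussian z • L.mulVec z j))
      (phaseMeasure N) := h12.add h3
  rw [integral_add h123 (integrable_stdGaussian.smul_const _),
    integral_add h12 h3, integral_add h1 h2, integral_stdGaussian_smul_mulVec_mul,
    integral_mul_const, integral_stdGaussian_smul_mulVec, integral_const_mul, h4,
    integral_smul_const, integral_stdGaussian]
  simp

end Moments

end Gaussian

section CoherentStates

variable {N : ℕ}

theorem hasSum_prod_exp (x : Fin N → ℂ)
    (hx : Summable fun n : Occ N => ∏ k, (x k ^ n k / ((n k).factorial : ℂ))) :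
    HasSum (fun n : Occ N => ∏ k, (x k ^ n k / ((n k).factorial : ℂ)))
      (Complex.exp (∑ k, x k)) := by
  let s : ℕ → Finset (Occ N) := fun M => Fintype.piFinset fun _ => Finset.range M
  have hs : Filter.Tendsto s Filter.atTop Filter.atTop := by
    refine Filter.tendsto_atTop_finset_of_monotone (fun a b hab => ?_) fun n => ?_
    · exact Fintype.piFinset_subset _ _ fun _ => Finset.range_mono hab
    · refine ⟨Finset.univ.sup n + 1, Fintype.mem_piFinset.2 fun k => ?_⟩
      exact Finset.mem_range.2 (Nat.lt_succ_of_le (Finset.le_sup (Finset.mem_univ k)))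
  have h1 := hx.hasSum.comp hs
  have h2 : Filter.Tendsto (fun M => ∏ k, ∑ j ∈ Finset.range M, (x k ^ j / (j.factorial : ℂ)))
      Filter.atTop (nhds (∏ k, Complex.exp (x k))) := by
    refine tendsto_finsetProd _ fun k _ => ?_
    have := (NormedSpace.expSeries_div_hasSum_exp (x k)).tendsto_sum_nat
    rwa [← Complex.exp_eq_exp_ℂ] at this
  have h3 : (∑' n : Occ N, ∏ k, (x k ^ n k / ((n k).factorial : ℂ))) =
      ∏ k, Complex.exp (x k) := by
    refine tendsto_nhds_unique h1 (h2.congr fun M => ?_)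
    exact Finset.prod_univ_sum (fun _ => Finset.range M)
      fun k j => x k ^ j / (j.factorial : ℂ)
  rw [Complex.exp_sum, ← h3]
  exact hx.hasSum

theorem inner_coherentState (β γ : Fin N → ℂ) :
    inner ℂ (coherentState β) (coherentState γ) =
      ((Real.exp (-(∑ k, ‖β k‖ ^ 2) / 2) * Real.exp (-(∑ k, ‖γ k‖ ^ 2) / 2) : ℝ) : ℂ) *
        Complex.exp (∑ k, star (β k) * γ k) := by
  have h1 := lp.hasSum_inner (𝕜 := ℂ) (coherentState β) (coherentState γ)
  set c : ℂ := ((Real.exp (-(∑ k, ‖β k‖ ^ 2) / 2) * Real.exp (-(∑ k, ‖γ k‖ ^ 2) / 2) : ℝ) : ℂ)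
    with hc
  have hc0 : c ≠ 0 := by
    rw [hc]
    exact_mod_cast (by positivity : Real.exp (-(∑ k, ‖β k‖ ^ 2) / 2) *
      Real.exp (-(∑ k, ‖γ k‖ ^ 2) / 2) ≠ 0)
  have h2 (n : Occ N) : inner ℂ (coherentState β n) (coherentState γ n) =
      c * ∏ k, ((star (β k) * γ k) ^ n k / ((n k).factorial : ℂ)) := by
    change inner ℂ (coherentCoeff β n) (coherentCoeff γ n) = _
    rw [RCLike.inner_apply', coherentCoeff, coherentCoeff, map_mul, map_prod, Complex.conj_ofReal,
      hc, mul_mul_mul_comm, ← Finset.prod_mul_distrib, Complex.ofReal_mul]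
    congr 1
    refine Finset.prod_congr rfl fun k _ => ?_
    rw [map_div₀, map_pow, Complex.conj_ofReal, div_mul_div_comm, ← Complex.ofReal_mul,
      Real.mul_self_sqrt (by positivity), mul_pow]
    simp
  simp only [h2] at h1
  have h3 := hasSum_prod_exp (fun k => star (β k) * γ k) ((summable_mul_left_iff hc0).1 h1.summable)
  exact h1.unique (h3.mul_left c)

theorem norm_sq_inner_coherentState (β γ : Fin N → ℂ) :
    ‖inner ℂ (coherentState β) (coherentState γ)‖ ^ 2 = stdGaussian (β - γ) := by
  rw [inner_coherentState, norm_mul, Complex.norm_exp, Complex.norm_real, Real.norm_of_nonneg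
    (by positivity), ← Real.exp_add, ← Real.exp_add, ← Real.exp_nat_mul, stdGaussian]
  congr 1
  rw [Complex.re_sum]
  have h (k : Fin N) : ‖(β - γ) k‖ ^ 2 = ‖β k‖ ^ 2 + ‖γ k‖ ^ 2 - 2 * (star (β k) * γ k).re := by
    simp only [Pi.sub_apply, ← Complex.normSq_eq_norm_sq, Complex.normSq_sub]
    simp
  simp_rw [h, Finset.sum_sub_distrib, Finset.sum_add_distrib, ← Finset.mul_sum]
  push_cast
  ring

theorem norm_coherentState (β : Fin N → ℂ) : ‖coherentState β‖ = 1 := by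
  have h := norm_sq_inner_coherentState β β
  rw [inner_self_eq_norm_sq_to_K, sub_self] at h
  have h1 : (‖coherentState β‖ ^ 2) ^ 2 = 1 := by
    simpa [stdGaussian] using h
  rwa [← pow_mul, pow_eq_one_iff_of_nonneg (norm_nonneg _) (by norm_num)] at h1

theorem hasSum_norm_sq_coherentCoeff (β : Fin N → ℂ) :
    HasSum (fun n => ‖coherentCoeff β n‖ ^ 2) 1 := by
  have h : HasSum (fun n => ‖coherentState β n‖ ^ 2) 1 := by
    have := lp.hasSum_norm (by norm_num) (coherentState β)
    rw [norm_coherentState] at this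
    simpa using this
  exact h

theorem stronglyMeasurable_coherentState :
    StronglyMeasurable fun β : Fin N → ℂ => coherentState β :=
  stronglyMeasurable_of_tendsto Filter.atTop
    (f := fun (s : Finset (Occ N)) (β : Fin N → ℂ) => ∑ n ∈ s, coherentCoeff β n • numberState n)
    (fun s => (continuous_finsetSum s fun n _ =>
      (continuous_coherentCoeff n).smul continuous_const).stronglyMeasurable)
    (tendsto_pi_nhds.2 fun β => hasSum_numberState (coherentState β))

theorem continuous_rankOne_self {H : Type*} [NormedAddCommGroup H] [InnerProductSpace ℂ H] :
    Continuous fun x : H => InnerProductSpace.rankOne ℂ x x :=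
  ((ContinuousLinearMap.smulRightL ℂ H H).continuous.comp (innerSL ℂ).continuous).clm_apply
    continuous_id

section Mixture

variable (T : Matrix (Fin N) (Fin N) ℂ) (α : Fin N → ℂ)

/-- The Gaussian mixture of the coherent states `|Tz + α⟩`. -/
def coherentMixture : FockSpace N →L[ℂ] FockSpace N :=
  ∫ z, (stdGaussian z : ℂ) • InnerProductSpace.rankOne ℂ (coherentState (T.mulVec z + α))
    (coherentState (T.mulVec z + α)) ∂phaseMeasure N

theorem aestronglyMeasurable_coherentState_affine :
    AEStronglyMeasurable (fun z => coherentState (T.mulVec z + α)) (phaseMeasure N) :=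
  (stronglyMeasurable_coherentState.comp_measurable
    (by fun_prop : Continuous fun z => T.mulVec z + α).measurable).aestronglyMeasurable

theorem integrable_rankOne_coherentState :
    Integrable (fun z => (stdGaussian z : ℂ) • InnerProductSpace.rankOne ℂ
      (coherentState (T.mulVec z + α)) (coherentState (T.mulVec z + α))) (phaseMeasure N) := by
  have hg : AEStronglyMeasurable (fun z : Fin N → ℂ => (stdGaussian z : ℂ)) (phaseMeasure N) :=
    Complex.continuous_ofReal.comp_aestronglyMeasurable integrable_stdGaussian.1
  refine integrable_stdGaussian.mono' (hg.smul
    (continuous_rankOne_self.comp_aestronglyMeasurable (aestronglyMeasurable_coherentState_affine T α)))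
    (.of_forall fun z => ?_)
  have h0 : 0 ≤ stdGaussian z := Real.exp_nonneg _
  rw [norm_smul, InnerProductSpace.norm_rankOne, norm_coherentState, Complex.norm_real,
    Real.norm_of_nonneg h0, mul_one, mul_one]

theorem inner_coherentMixture (x y : FockSpace N) :
    inner ℂ x (coherentMixture T α y) =
      ∫ z, (stdGaussian z : ℂ) * (inner ℂ (coherentState (T.mulVec z + α)) y *
        inner ℂ x (coherentState (T.mulVec z + α))) ∂phaseMeasure N := by
  have h := integrable_rankOne_coherentState T α
  rw [coherentMixture, ContinuousLinearMap.integral_apply h, ← integral_inner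
    (h.apply_continuousLinearMap y)]
  refine integral_congr_ae (.of_forall fun z => ?_)
  simp only [smul_apply, InnerProductSpace.rankOne_apply]
  rw [inner_smul_right, inner_smul_right]

theorem inner_coherentMixture_self (x : FockSpace N) :
    inner ℂ x (coherentMixture T α x) =
      ((∫ z, stdGaussian z * ‖inner ℂ x (coherentState (T.mulVec z + α))‖ ^ 2
        ∂phaseMeasure N : ℝ) : ℂ) := by
  rw [inner_coherentMixture, ← integral_complex_ofReal]
  refine integral_congr_ae (.of_forall fun z => ?_)
  simp only
  rw [← inner_conj_symm _ x, ← Complex.normSq_eq_conj_mul_self, Complex.normSq_eq_norm_sq,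
    Complex.ofReal_mul]

theorem isPositive_coherentMixture : (coherentMixture T α).IsPositive := by
  rw [ContinuousLinearMap.isPositive_iff_complex]
  intro x
  rw [← inner_conj_symm, inner_coherentMixture_self, Complex.conj_ofReal]
  refine ⟨by simp, ?_⟩
  simp only [RCLike.re_eq_complex_re, Complex.ofReal_re]
  exact integral_nonneg fun z => mul_nonneg (Real.exp_nonneg _) (sq_nonneg _)

theorem inner_numberState_left (n : Occ N) (x : FockSpace N) : inner ℂ (numberState n) x = x n := by
  rw [numberState, lp.inner_single_left]
  simp

theorem isDensityOperator_coherentMixture : IsDensityOperator (coherentMixture T α) := by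
  refine ⟨isPositive_coherentMixture T α, ?_⟩
  simp_rw [inner_coherentMixture_self, inner_numberState_left]
  rw [← Complex.ofReal_one, Complex.hasSum_ofReal]
  let F : Occ N → (Fin N → ℂ) → ℝ :=
    fun n z => stdGaussian z * ‖coherentCoeff (T.mulVec z + α) n‖ ^ 2
  have hF (n : Occ N) (z : Fin N → ℂ) : 0 ≤ F n z :=
    mul_nonneg (Real.exp_nonneg _) (sq_nonneg _)
  have hs (z : Fin N → ℂ) : HasSum (fun n => F n z) (stdGaussian z) := by
    simpa using (hasSum_norm_sq_coherentCoeff (T.mulVec z + α)).mul_left (stdGaussian z)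
  rw [← integral_stdGaussian (N := N)]
  refine hasSum_integral_of_dominated_convergence (F := F) F (fun n => ?_)
    (fun n => .of_forall fun z => (Real.norm_of_nonneg (hF n z)).le)
    (.of_forall fun z => (hs z).summable) ?_ (.of_forall hs)
  · refine integrable_stdGaussian.1.mul (Continuous.aestronglyMeasurable ?_)
    exact ((continuous_coherentCoeff n).comp (by fun_prop :
      Continuous fun z => T.mulVec z + α)).norm.pow 2
  · simpa only [(hs _).tsum_eq] using integrable_stdGaussian

theorem husimiQ_coherentMixture (β : Fin N → ℂ) :
    husimiQ (coherentMixture T α) β =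
      ∫ z, stdGaussian z * stdGaussian (β - α - T.mulVec z) ∂phaseMeasure N := by
  rw [husimiQ, inner_coherentMixture_self, Complex.ofReal_re]
  simp_rw [norm_sq_inner_coherentState, sub_add_eq_sub_sub_swap]

end Mixture

section Convolution

open Matrix

variable (T : Matrix (Fin N) (Fin N) ℂ)

theorem posDef_one_add_mul_conjTranspose : (1 + T * Tᴴ).PosDef :=
  PosDef.one.add_posSemidef (posSemidef_self_mul_conjTranspose T)

theorem inv_one_add_mul_conjTranspose :
    (1 + T * Tᴴ)⁻¹ = 1 - T * (1 + Tᴴ * T)⁻¹ * Tᴴ := by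
  have hK : IsUnit (1 + Tᴴ * T).det := by
    simpa using (posDef_one_add_mul_conjTranspose Tᴴ).det_pos.ne'.isUnit
  refine inv_eq_left_inv ?_
  have h1 : (1 + Tᴴ * T)⁻¹ * Tᴴ * (1 + T * Tᴴ) = Tᴴ := by
    have : Tᴴ * (1 + T * Tᴴ) = (1 + Tᴴ * T) * Tᴴ := by noncomm_ring
    rw [mul_assoc, this, ← mul_assoc, nonsing_inv_mul _ hK, one_mul]
  rw [sub_mul, one_mul, mul_assoc T, mul_assoc T, h1]
  simp

theorem completing_square {K : Matrix (Fin N) (Fin N) ℂ} (hK : K = 1 + Tᴴ * T)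
    (γ z : Fin N → ℂ) :
    star z ⬝ᵥ z + star (γ - T *ᵥ z) ⬝ᵥ (γ - T *ᵥ z) =
      star (z - K⁻¹ *ᵥ (Tᴴ *ᵥ γ)) ⬝ᵥ (K *ᵥ (z - K⁻¹ *ᵥ (Tᴴ *ᵥ γ))) +
        star γ ⬝ᵥ ((1 + T * Tᴴ)⁻¹ *ᵥ γ) := by
  have hu : IsUnit K.det := by
    rw [hK]
    simpa using (posDef_one_add_mul_conjTranspose Tᴴ).det_pos.ne'.isUnit
  have hKH : Kᴴ = K := by rw [hK]; simp
  have hKi : (K⁻¹)ᴴ = K⁻¹ := by rw [conjTranspose_nonsing_inv, hKH]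
  rw [inv_one_add_mul_conjTranspose, ← hK]
  simp only [star_sub, star_mulVec, conjTranspose_mul, hKi, conjTranspose_conjTranspose, mulVec_sub, sub_dotProduct,
    dotProduct_sub, ← dotProduct_mulVec, mulVec_mulVec, sub_mulVec, one_mulVec]
  simp only [← mul_assoc, mul_nonsing_inv _ hu, one_mul]
  simp only [mul_assoc, nonsing_inv_mul _ hu, mul_one]
  rw [hK]
  simp only [add_mulVec, dotProduct_add, one_mulVec]
  ring

theorem integral_stdGaussian_mul_stdGaussian (γ : Fin N → ℂ) :
    ∫ z, stdGaussian z * stdGaussian (γ - T *ᵥ z) ∂phaseMeasure N =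
      (1 + T * Tᴴ).det.re⁻¹ * Real.exp (-(star γ ⬝ᵥ ((1 + T * Tᴴ)⁻¹ *ᵥ γ)).re) := by
  set K := 1 + Tᴴ * T with hK
  have hKpos : K.PosDef := by simpa [hK] using posDef_one_add_mul_conjTranspose Tᴴ
  have hdet : (1 + T * Tᴴ).det = K.det := det_one_add_mul_comm T Tᴴ
  set z₀ := K⁻¹ *ᵥ (Tᴴ *ᵥ γ)
  have hre : 0 < K.det.re := (Complex.pos_iff.1 hKpos.det_pos).1
  have him : K.det = (K.det.re : ℂ) :=
    Complex.ext (by simp) (by simpa using (Complex.pos_iff.1 hKpos.det_pos).2.symm)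
  have hinv : (K⁻¹).det.re = (K.det.re)⁻¹ := by
    rw [det_nonsing_inv, Ring.inverse_eq_inv', him, ← Complex.ofReal_inv, Complex.ofReal_re,
      Complex.ofReal_re]
  have h1 (z : Fin N → ℂ) : stdGaussian z * stdGaussian (γ - T *ᵥ z) =
      (K.det.re⁻¹ * Real.exp (-(star γ ⬝ᵥ ((1 + T * Tᴴ)⁻¹ *ᵥ γ)).re)) *
        gaussianWeight K⁻¹ z₀ z := by
    have h2 := congrArg Complex.re (completing_square T hK γ z)
    rw [Complex.add_re, Complex.add_re] at h2
    rw [stdGaussian, stdGaussian, ← star_dotProduct_self_re, ← star_dotProduct_self_re,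
      ← Real.exp_add, ← neg_add, h2, neg_add, Real.exp_add, gaussianWeight, hinv,
      nonsing_inv_nonsing_inv _ hKpos.det_pos.ne'.isUnit]
    field_simp
    rfl
  simp_rw [h1]
  rw [integral_const_mul, integral_gaussianWeight hKpos.inv, mul_one, hdet]

end Convolution

open scoped MatrixOrder Matrix.Norms.L2Operator in
theorem exists_husimiQ_eq_gaussianWeight {C : Matrix (Fin N) (Fin N) ℂ} (hC : C.PosSemidef)
    (α : Fin N → ℂ) :
    ∃ ρ : FockSpace N →L[ℂ] FockSpace N, IsDensityOperator ρ ∧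
      ∀ β, husimiQ ρ β = gaussianWeight (C + 1) α β := by
  obtain ⟨B, hB⟩ := CStarAlgebra.nonneg_iff_eq_star_mul_self.mp hC.nonneg
  refine ⟨coherentMixture B.conjTranspose α, isDensityOperator_coherentMixture _ _, fun β => ?_⟩
  rw [husimiQ_coherentMixture, integral_stdGaussian_mul_stdGaussian, gaussianWeight,
    Matrix.conjTranspose_conjTranspose, hB, Matrix.star_eq_conjTranspose, add_comm]

end CoherentStates

section Entropy

variable {N : ℕ}

theorem re_trace_cfc_log {M : Matrix (Fin N) (Fin N) ℂ} (hM : M.PosDef) :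
    (Matrix.trace (cfc Real.log M)).re = Real.log M.det.re := by
  rw [hM.isHermitian.cfc_eq, Matrix.IsHermitian.cfc, Unitary.conjStarAlgAut_apply,
    Matrix.trace_mul_cycle, Unitary.coe_star_mul_self, one_mul, Matrix.trace_diagonal,
    hM.isHermitian.det_eq_prod_eigenvalues]
  rw [← RCLike.ofReal_prod]
  simp only [Function.comp_apply, Complex.coe_algebraMap, Complex.re_sum, Complex.ofReal_re]
  exact (Real.log_prod fun i _ => (hM.eigenvalues_pos i).ne').symm

theorem wehrlEntropy_eq (kB : ℝ) (ρ : FockSpace N →L[ℂ] FockSpace N) :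
    wehrlEntropy kB ρ =
      -kB * ∫ β, husimiQ ρ β * Real.log (husimiQ ρ β) ∂phaseMeasure N := by
  rw [wehrlEntropy, integral_phaseMeasure, integral_div, smul_eq_mul, div_eq_inv_mul]

variable {ρ : FockSpace N →L[ℂ] FockSpace N} {r : Matrix (Fin N) (Fin N) ℂ} {α : Fin N → ℂ}

theorem husimiQ_nonneg (hρ : ρ.IsPositive) (β : Fin N → ℂ) : 0 ≤ husimiQ ρ β := by
  rw [husimiQ_eq hρ]
  positivity

theorem husimiQ_le_one (hρ : IsDensityOperator ρ) (β : Fin N → ℂ) : husimiQ ρ β ≤ 1 := by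
  have h1 := hasSum_norm_sq_coherentCoeff β
  have h2 : HasSum (fun n => ‖amplitude ρ n‖ ^ 2) 1 := by
    have := hρ.hasSum_inner_amplitude
    simp_rw [inner_self_eq_norm_sq_to_K] at this
    rw [← RCLike.hasSum_ofReal ℂ]
    simpa using this
  have h3 : ‖bargmann (amplitude ρ) β‖ ≤ (1 + 1) / 2 := by
    refine tsum_of_norm_bounded ((h1.add h2).div_const 2) fun n => ?_
    rw [norm_smul]
    linarith [two_mul_le_add_sq ‖coherentCoeff β n‖ ‖amplitude ρ n‖]
  rw [husimiQ_eq hρ.isPositive]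
  exact pow_le_one₀ (norm_nonneg _) (by linarith)

theorem centered_mul_eq (q x a y b : ℂ) :
    (x - a) * star (y - b) * q =
      x * star y * q + (-star b) * (x * q) + (-a) * star (y * star q) + (a * star b) * q := by
  simp only [star_sub, star_mul', star_star]
  ring

theorem HasRSF.star_first (h : HasRSF ρ r α) (hρ : IsDensityOperator ρ) (j : Fin N) :
    Integrable (fun β => star (β j * star (husimiQ ρ β : ℂ))) (phaseMeasure N) ∧
      ∫ β, star (β j * star (husimiQ ρ β : ℂ)) ∂phaseMeasure N = star (α j) := by
  simp only [Complex.star_def, Complex.conj_ofReal]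
  refine ⟨Complex.conjCLE.toContinuousLinearMap.integrable_comp (h.integrable_first hρ j), ?_⟩
  rw [integral_conj, h.integral_first hρ j]

theorem HasRSF.integrable_centered (h : HasRSF ρ r α) (hρ : IsDensityOperator ρ) (k j : Fin N) :
    Integrable (fun β => (β k - α k) * star (β j - α j) * (husimiQ ρ β : ℂ))
      (phaseMeasure N) := by
  simp_rw [centered_mul_eq]
  exact (((h.integrable_second hρ k j).add ((h.integrable_first hρ k).const_mul _)).add
    ((h.star_first hρ j).1.const_mul _)).add (hρ.integrable_husimiQ.ofReal.const_mul _)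

theorem HasRSF.integral_centered (h : HasRSF ρ r α) (hρ : IsDensityOperator ρ) (k j : Fin N) :
    ∫ β, (β k - α k) * star (β j - α j) * (husimiQ ρ β : ℂ) ∂phaseMeasure N =
      (correlationMatrix r α + 1) k j := by
  simp_rw [centered_mul_eq]
  have h1 := h.integrable_second hρ k j
  have h2 := (h.integrable_first hρ k).const_mul (-star (α j))
  have h3 := (h.star_first hρ j).1.const_mul (-α k)
  have h4 : Integrable (fun β => (α k * star (α j)) * (husimiQ ρ β : ℂ)) (phaseMeasure N) :=
    hρ.integrable_husimiQ.ofReal.const_mul _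
  have h12 : Integrable (fun β => β k * star (β j) * (husimiQ ρ β : ℂ) +
    -star (α j) * (β k * (husimiQ ρ β : ℂ))) (phaseMeasure N) := h1.add h2
  have h123 : Integrable (fun β => β k * star (β j) * (husimiQ ρ β : ℂ) +
    -star (α j) * (β k * (husimiQ ρ β : ℂ)) + -α k * star (β j * star (husimiQ ρ β : ℂ)))
    (phaseMeasure N) := h12.add h3
  rw [integral_add h123 h4, integral_add h12 h3, integral_add h1 h2, h.integral_second hρ,
    integral_const_mul, integral_const_mul, integral_const_mul, h.integral_first hρ,
    (h.star_first hρ j).2, integral_complex_ofReal, hρ.integral_husimiQ]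
  simp only [correlationMatrix, Matrix.add_apply, Matrix.sub_apply, Matrix.vecMulVec_apply,
    Pi.star_apply, Complex.ofReal_one]
  ring

/-- The quadratic form `(β - α)† (r_α + 1)⁻¹ (β - α)`. -/
def correlationForm (r : Matrix (Fin N) (Fin N) ℂ) (α β : Fin N → ℂ) : ℂ :=
  star (β - α) ⬝ᵥ ((correlationMatrix r α + 1)⁻¹).mulVec (β - α)

theorem correlationForm_mul (β : Fin N → ℂ) (q : ℂ) :
    correlationForm r α β * q = ∑ j, ∑ k, (correlationMatrix r α + 1)⁻¹ j k *
      ((β k - α k) * star (β j - α j) * q) := by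
  simp only [correlationForm, dotProduct, Matrix.mulVec, Finset.sum_mul, Finset.mul_sum,
    Pi.star_apply, Pi.sub_apply]
  refine Finset.sum_congr rfl fun j _ => Finset.sum_congr rfl fun k _ => ?_
  ring

theorem posDef_correlationMatrix_add_one (hC : (correlationMatrix r α).PosSemidef) :
    (correlationMatrix r α + 1).PosDef := by
  rw [add_comm]
  exact Matrix.PosDef.one.add_posSemidef hC

theorem HasRSF.integrable_form (h : HasRSF ρ r α) (hρ : IsDensityOperator ρ) :
    Integrable (fun β => husimiQ ρ β * (correlationForm r α β).re) (phaseMeasure N) := by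
  have h1 : Integrable (fun β => correlationForm r α β * (husimiQ ρ β : ℂ)) (phaseMeasure N) := by
    simp_rw [correlationForm_mul]
    exact integrable_finsetSum _ fun j _ => integrable_finsetSum _ fun k _ =>
      (h.integrable_centered hρ k j).const_mul _
  refine h1.re.congr (.of_forall fun β => ?_)
  simp [mul_comm]

theorem HasRSF.integral_form (h : HasRSF ρ r α) (hρ : IsDensityOperator ρ) :
    ∫ β, husimiQ ρ β * (correlationForm r α β).re ∂phaseMeasure N = N := by
  have hi (j k : Fin N) := (h.integrable_centered hρ k j).const_mul
    ((correlationMatrix r α + 1)⁻¹ j k)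
  have h1 : Integrable (fun β => correlationForm r α β * (husimiQ ρ β : ℂ)) (phaseMeasure N) := by
    simp_rw [correlationForm_mul]
    exact integrable_finsetSum _ fun j _ => integrable_finsetSum _ fun k _ => hi j k
  have h2 : ∫ β, correlationForm r α β * (husimiQ ρ β : ℂ) ∂phaseMeasure N = N := by
    simp_rw [correlationForm_mul]
    rw [integral_finsetSum _ fun j _ => integrable_finsetSum _ fun k _ => hi j k]
    simp_rw [integral_finsetSum _ fun k _ => hi _ k, integral_const_mul, h.integral_centered hρ]
    have hM := posDef_correlationMatrix_add_one (correlationMatrix_posSemidef hρ h)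
    have h3 := congrArg Matrix.trace
      (Matrix.nonsing_inv_mul (correlationMatrix r α + 1) hM.det_pos.ne'.isUnit)
    rw [Matrix.trace_one, Fintype.card_fin] at h3
    simpa only [Matrix.trace, Matrix.diag, Matrix.mul_apply] using h3
  have h4 := integral_re h1
  simp only [RCLike.re_eq_complex_re] at h4
  rw [h2, Complex.natCast_re] at h4
  rw [← h4]
  refine integral_congr_ae (.of_forall fun β => ?_)
  simp [mul_comm]

theorem det_re_pos (hC : (correlationMatrix r α).PosSemidef) :
    0 < (correlationMatrix r α + 1).det.re :=
  (Complex.pos_iff.1 (posDef_correlationMatrix_add_one hC).det_pos).1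

theorem gaussianQ_pos (hC : (correlationMatrix r α).PosSemidef) (β : Fin N → ℂ) :
    0 < gaussianQ r α β :=
  mul_pos (inv_pos.2 (det_re_pos hC)) (Real.exp_pos _)

theorem log_gaussianQ (hC : (correlationMatrix r α).PosSemidef) (β : Fin N → ℂ) :
    Real.log (gaussianQ r α β) =
      -Real.log (correlationMatrix r α + 1).det.re - (correlationForm r α β).re := by
  rw [gaussianQ, Real.log_mul (inv_pos.2 (det_re_pos hC)).ne' (Real.exp_pos _).ne', Real.log_inv,
    Real.log_exp, correlationForm]
  ring

theorem neg_mul_log_le {q g : ℝ} (hq : 0 ≤ q) (hg : 0 < g) :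
    -(q * Real.log q) ≤ -(q * Real.log g) + (g - q) := by
  rcases hq.eq_or_lt with rfl | hq
  · simpa using hg.le
  · have h1 := mul_le_mul_of_nonneg_left (Real.log_le_sub_one_of_pos (div_pos hg hq)) hq.le
    rw [Real.log_div hg.ne' hq.ne', mul_sub, mul_sub, mul_div_cancel₀ _ hq.ne'] at h1
    linarith

/-- The bound on `-Q log Q` given by Gibbs' inequality against the Gaussian `gaussianQ r α`. -/
def gibbsBound (ρ : FockSpace N →L[ℂ] FockSpace N) (r : Matrix (Fin N) (Fin N) ℂ)
    (α β : Fin N → ℂ) : ℝ :=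
  Real.log (correlationMatrix r α + 1).det.re * husimiQ ρ β +
    husimiQ ρ β * (correlationForm r α β).re + (gaussianQ r α β - husimiQ ρ β)

theorem HasRSF.neg_mul_log_le_gibbsBound (h : HasRSF ρ r α) (hρ : IsDensityOperator ρ)
    (β : Fin N → ℂ) : -(husimiQ ρ β * Real.log (husimiQ ρ β)) ≤ gibbsBound ρ r α β := by
  have hC := correlationMatrix_posSemidef hρ h
  refine (neg_mul_log_le (husimiQ_nonneg hρ.isPositive β) (gaussianQ_pos hC β)).trans (le_of_eq ?_)
  rw [log_gaussianQ hC, gibbsBound]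
  ring

theorem HasRSF.integrable_gibbsBound (h : HasRSF ρ r α) (hρ : IsDensityOperator ρ) :
    Integrable (gibbsBound ρ r α) (phaseMeasure N) :=
  ((hρ.integrable_husimiQ.const_mul _).add (h.integrable_form hρ)).add
    ((integrable_gaussianWeight (posDef_correlationMatrix_add_one
      (correlationMatrix_posSemidef hρ h)) α).sub hρ.integrable_husimiQ)

theorem HasRSF.integral_gibbsBound (h : HasRSF ρ r α) (hρ : IsDensityOperator ρ) :
    ∫ β, gibbsBound ρ r α β ∂phaseMeasure N =
      Real.log (correlationMatrix r α + 1).det.re + N := by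
  have hM := posDef_correlationMatrix_add_one (correlationMatrix_posSemidef hρ h)
  have h1 := hρ.integrable_husimiQ.const_mul (Real.log (correlationMatrix r α + 1).det.re)
  have hG : Integrable (gaussianQ r α) (phaseMeasure N) := integrable_gaussianWeight hM α
  have hG1 : ∫ β, gaussianQ r α β ∂phaseMeasure N = 1 := integral_gaussianWeight hM α
  have h12 : Integrable (fun β => Real.log (correlationMatrix r α + 1).det.re * husimiQ ρ β +
    husimiQ ρ β * (correlationForm r α β).re) (phaseMeasure N) := h1.add (h.integrable_form hρ)
  have h3 : Integrable (fun β => gaussianQ r α β - husimiQ ρ β) (phaseMeasure N) :=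
    hG.sub hρ.integrable_husimiQ
  simp only [gibbsBound]
  rw [integral_add h12 h3, integral_add h1 (h.integrable_form hρ),
    integral_sub hG hρ.integrable_husimiQ, integral_const_mul, hρ.integral_husimiQ,
    h.integral_form hρ, hG1]
  ring

theorem HasRSF.integrable_mul_log (h : HasRSF ρ r α) (hρ : IsDensityOperator ρ) :
    Integrable (fun β => husimiQ ρ β * Real.log (husimiQ ρ β)) (phaseMeasure N) := by
  refine (h.integrable_gibbsBound hρ).mono' ?_ (.of_forall fun β => ?_)
  · have := hρ.integrable_husimiQ.1.aemeasurable
    exact (this.mul (Real.measurable_log.comp_aemeasurable this)).aestronglyMeasurable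
  · rw [Real.norm_of_nonpos]
    · exact h.neg_mul_log_le_gibbsBound hρ β
    · exact mul_nonpos_of_nonneg_of_nonpos (husimiQ_nonneg hρ.isPositive β)
        (Real.log_nonpos (husimiQ_nonneg hρ.isPositive β) (husimiQ_le_one hρ β))

theorem reducedWehrlEntropy_eq (kB : ℝ) (hC : (correlationMatrix r α).PosSemidef) :
    reducedWehrlEntropy kB r α = kB * (Real.log (correlationMatrix r α + 1).det.re + N) := by
  rw [reducedWehrlEntropy, re_trace_cfc_log (posDef_correlationMatrix_add_one hC)]
  ring

theorem HasRSF.wehrlEntropy_le (h : HasRSF ρ r α) (hρ : IsDensityOperator ρ) {kB : ℝ}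
    (hkB : 0 < kB) : wehrlEntropy kB ρ ≤ reducedWehrlEntropy kB r α := by
  rw [reducedWehrlEntropy_eq kB (correlationMatrix_posSemidef hρ h), wehrlEntropy_eq,
    neg_mul_comm, ← integral_neg, ← h.integral_gibbsBound hρ]
  exact mul_le_mul_of_nonneg_left (integral_mono (h.integrable_mul_log hρ).neg
    (h.integrable_gibbsBound hρ) (h.neg_mul_log_le_gibbsBound hρ)) hkB.le

theorem HasRSF.wehrlEntropy_eq_of_husimiQ_eq (h : HasRSF ρ r α) (hρ : IsDensityOperator ρ) (kB : ℝ)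
    (hQ : ∀ β, husimiQ ρ β = gaussianQ r α β) :
    wehrlEntropy kB ρ = reducedWehrlEntropy kB r α := by
  have hC := correlationMatrix_posSemidef hρ h
  rw [reducedWehrlEntropy_eq kB hC, wehrlEntropy_eq, neg_mul_comm, ← integral_neg,
    ← h.integral_gibbsBound hρ]
  congr 2
  ext β
  rw [gibbsBound, hQ, log_gaussianQ hC]
  ring

theorem hasRSF_of_husimiQ_eq (hC : (correlationMatrix r α).PosSemidef) (hρ : IsDensityOperator ρ)
    (hQ : ∀ β, husimiQ ρ β = gaussianQ r α β) : HasRSF ρ r α := by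
  have hM := posDef_correlationMatrix_add_one hC
  obtain ⟨r', α', h⟩ := exists_hasRSF hρ fun k => by
    refine (integrable_gaussianWeight_smul_mul hM α k k).re.congr (.of_forall fun β => ?_)
    simp only [hQ]
    rw [← Complex.coe_smul, smul_eq_mul, RCLike.re_eq_complex_re, Complex.re_ofReal_mul,
      ← starRingEnd_apply, Complex.mul_conj, Complex.ofReal_re, Complex.normSq_eq_norm_sq, mul_comm]
    rfl
  have hα : α' = α := by
    ext k
    rw [← h.integral_first hρ k, ← integral_gaussianWeight_smul_apply hM α k]
    refine integral_congr_ae (.of_forall fun β => ?_)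
    simp only [hQ]
    rw [← Complex.coe_smul, smul_eq_mul, mul_comm]
    rfl
  have hr : r' = r := by
    ext k j
    have h1 : (r' + 1) k j = (r + 1) k j := by
      rw [← h.integral_second hρ k j]
      calc _ = ∫ β, gaussianWeight (correlationMatrix r α + 1) α β • (β k * star (β j))
            ∂phaseMeasure N := by
            refine integral_congr_ae (.of_forall fun β => ?_)
            simp only [hQ]
            rw [← Complex.coe_smul, smul_eq_mul, mul_comm]
            rfl
        _ = _ := by
            rw [integral_gaussianWeight_smul_mul hM]
            simp only [correlationMatrix, Matrix.add_apply, Matrix.sub_apply,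
              Matrix.vecMulVec_apply, Pi.star_apply]
            ring
    simpa using h1
  rwa [hα, hr] at h

end Entropy

end BosonField

end

theorem mainTheorem5 {N : ℕ} (kB : ℝ) (hkB : 0 < kB)
    (r : Matrix (Fin N) (Fin N) ℂ) (α : Fin N → ℂ)
    (hRSF : ∃ ρ : BosonField.FockSpace N →L[ℂ] BosonField.FockSpace N,
      BosonField.IsDensityOperator ρ ∧ BosonField.HasRSF ρ r α) :
    (BosonField.correlationMatrix r α).PosSemidef ∧
    (∀ ρ : BosonField.FockSpace N →L[ℂ] BosonField.FockSpace N,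
      BosonField.IsDensityOperator ρ → BosonField.HasRSF ρ r α →
        Integrable (fun β : Fin N → ℂ =>
          BosonField.husimiQ ρ β * Real.log (BosonField.husimiQ ρ β))) ∧
    IsGreatest
      {s : ℝ | ∃ ρ : BosonField.FockSpace N →L[ℂ] BosonField.FockSpace N,
        BosonField.IsDensityOperator ρ ∧ BosonField.HasRSF ρ r α ∧
          s = BosonField.wehrlEntropy kB ρ}
      (BosonField.reducedWehrlEntropy kB r α) ∧
    (∃ ρ : BosonField.FockSpace N →L[ℂ] BosonField.FockSpace N,
      BosonField.IsDensityOperator ρ ∧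
        ∀ β : Fin N → ℂ, BosonField.husimiQ ρ β = BosonField.gaussianQ r α β) ∧
    (∀ ρ : BosonField.FockSpace N →L[ℂ] BosonField.FockSpace N,
      BosonField.IsDensityOperator ρ →
      (∀ β : Fin N → ℂ, BosonField.husimiQ ρ β = BosonField.gaussianQ r α β) →
        BosonField.HasRSF ρ r α ∧
          BosonField.wehrlEntropy kB ρ = BosonField.reducedWehrlEntropy kB r α) := by
  obtain ⟨ρ₀, hρ₀, h₀⟩ := hRSF
  have hC := BosonField.correlationMatrix_posSemidef hρ₀ h₀
  obtain ⟨ρ, hρ, hQ⟩ := BosonField.exists_husimiQ_eq_gaussianWeight hC α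
  have h := BosonField.hasRSF_of_husimiQ_eq hC hρ hQ
  refine ⟨hC, fun σ hσ h => BosonField.integrable_phaseMeasure.1 (h.integrable_mul_log hσ),
    ⟨⟨ρ, hρ, h, (h.wehrlEntropy_eq_of_husimiQ_eq hρ kB hQ).symm⟩, ?_⟩, ⟨ρ, hρ, hQ⟩,
    fun σ hσ hQ => ?_⟩
  · rintro _ ⟨σ, hσ, h, rfl⟩
    exact h.wehrlEntropy_le hσ hkB
  · have h := BosonField.hasRSF_of_husimiQ_eq hC hσ hQ
    exact ⟨h, h.wehrlEntropy_eq_of_husimiQ_eq hσ kB hQ⟩
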